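/- Let $k>0$ and let the sign $\pm$ be fixed, the upper one going with Hankel functions of the first kind and the lower one with those of the second kind: $H_\nu^{(1,2)}=J_\nu\pm iY_\nu$. Let $\mathbf H_\nu$ be the Struve functions, $g(\mathbf r,\mathbf r')=\frac i4H_0^{(1,2)}(k|\mathbf r-\mathbf r'|)$ on $\mathbb R^2$, and let $\mathrm{p.v.}\!\int$ denote the Cauchy principal value. Consider a finite mesh of nondegenerate oriented segments $S_n\subset\mathbb R^2$ with extrema $\mathbf r_A^n\ne\mathbf r_B^n$ among the mesh nodes, length $l_n$ and unit normal $\mathbf n_n=\frac1{l_n}(y_B^n-y_A^n,\;x_A^n-x_B^n)$. For a node $j$ that is an extremum of $S_n$ let $p_j^n(\mathbf r)=1-t$ if $j$ is the node $\mathbf r_A^n$ and $p_j^n(\mathbf r)=t$ if $j$ is the node $\mathbf r_B^n$, where $t=l_n^{-2}(\mathbf r-\mathbf r_A^n)\cdot(\mathbf r_B^n-\mathbf r_A^n)$: this is the hat function, extended to the plane constantly along $\mathbf n_n$. With $\mathrm{curl}_{S}=n_x\partial_y-n_y\partial_x$, the variational hypersingular matrix is $$N_{ij}=\sum_{m\ni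 i}\sum_{n\ni j}\int_{S_m}d\mathbf r\,\mathrm{p.v.}\!\int_{S_n}d\mathbf r'\,g(\mathbf r,\mathbf r')\big[k^2(\mathbf n_m\cdot\mathbf n_n)\,p_i^m(\mathbf r)p_j^n(\mathbf r')-\mathrm{curl}_{S_m}p_i^m(\mathbf r)\,\mathrm{curl}_{S_n}'p_j^n(\mathbf r')\big].$$ Let $\widetilde\Upsilon_{ab}^n$, $a,b\in\{1,2\}$, be the term with $m=n$ in which $i$ and $j$ are the local vertices $a$ and $b$ of $S_n$ (vertex $1$ is $\mathbf r_A^n$, vertex $2$ is $\mathbf r_B^n$). With $\varphi_1(t)=1-t$ and $\varphi_2(t)=t$, let $$I_{ab}^n=\frac i4\int_0^{l_n}dx\,\mathrm{p.v.}\!\int_{-x}^{l_n-x}dx'\,H_0^{(1,2)}(k|x'|)\,\varphi_a\!\left(\tfrac{x}{l_n}\right)\varphi_b\!\left(\tfrac{x'+x}{l_n}\right),$$ $$\mathcal I_0(\sigma)=\int_0^\sigma H_0^{(1,2)}(x)\,dx,\qquad \Gamma_0(\sigma)=\int_0^\sigma\mathcal I_0(x)\,dx,\qquad \Gamma_2(\sigma)=\int_0^\sigma\mathcal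 I_0(x)\,x(x-\sigma)\,dx .$$ Then the integrals defining $\widetilde\Upsilon_{ab}^n$, $I_{ab}^n$, $\int_{S_n}d\mathbf r\,\mathrm{p.v.}\!\int_{S_n}d\mathbf r'\,g(\mathbf r,\mathbf r')$, $\Gamma_0(kl_n)$ and $\Gamma_2(kl_n)$ exist, and: 1. $\mathrm{curl}_{S_n}p_j^n=-1/l_n$ if $j$ is the node $\mathbf r_A^n$, and $\mathrm{curl}_{S_n}p_j^n=1/l_n$ if $j$ is the node $\mathbf r_B^n$. 2. The coincident-element contributions to $N_{ij}$ (those with $m=n$) are $$\widetilde\Upsilon_{11}^n=\widetilde\Upsilon_{22}^n=k^2I_{11}^n-\frac1{l_n^2}\int_{S_n}d\mathbf r\,\mathrm{p.v.}\!\int_{S_n}d\mathbf r'\,g(\mathbf r,\mathbf r')=k^2I_{11}^n-\frac{i}{2k^2l_n^2}\Gamma_0(kl_n),$$ $$\widetilde\Upsilon_{12}^n=\widetilde\Upsilon_{21}^n=k^2I_{12}^n+\frac1{l_n^2}\int_{S_n}d\mathbf r\,\mathrm{p.v.}\!\int_{S_n}d\mathbf r'\,g(\mathbf r,\mathbf r')=k^2I_{12}^n+\frac{i}{2k^2l_n^2}\Gamma_0(kl_n).$$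 3. Here $$I_{11}^n=I_{22}^n=\frac{i\pi}{8k^2}\big[H_1^{(1,2)}(kl_n)\mathbf H_0(kl_n)-H_0^{(1,2)}(kl_n)\mathbf H_1(kl_n)\big]-\frac{i}{2k^2}H_2^{(1,2)}(kl_n)\pm\frac{2}{\pi k^4l_n^2}+\frac{i}{4k^2}\Gamma_0(kl_n)+\frac{i}{2k^4l_n^2}\Gamma_2(kl_n),$$ $$I_{12}^n=I_{21}^n=-I_{11}^n+\frac{i}{4k^2}\Gamma_0(kl_n),$$ $$\Gamma_0(kl_n)=\frac\pi2\int_0^{kl_n}x\,\big[H_0^{(1,2)}(x)\mathbf H_{-1}(x)+H_1^{(1,2)}(x)\mathbf H_0(x)\big]dx,$$ $$\Gamma_2(kl_n)=\frac\pi2\int_0^{kl_n}x^2(x-kl_n)\big[H_0^{(1,2)}(x)\mathbf H_{-1}(x)+H_1^{(1,2)}(x)\mathbf H_0(x)\big]dx.$$ -/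

import Mathlib

open Real Set Filter Topology MeasureTheory

noncomputable section

namespace HelmholtzBEM

/-! ### Bessel, Hankel and Struve functions of integer order, real argument -/

/-- Bessel function of the first kind `J_n`. -/
def besselJ (n : ℕ) (x : ℝ) : ℝ :=
  ∑' m : ℕ, (-1) ^ m / ((m.factorial : ℝ) * ((m + n).factorial : ℝ)) * (x / 2) ^ (2 * m + n)

/-- The digamma function at a positive integer: `ψ(m + 1) = -γ + 1 + 1/2 + ⋯ + 1/m`. -/
def digammaSucc (m : ℕ) : ℝ := -eulerMascheroniConstant + (harmonic m : ℝ)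

/-- Bessel function of the second kind `Y_n`, for `x > 0`, by its standard expansion. -/
def besselY (n : ℕ) (x : ℝ) : ℝ :=
  -(1 / π) * ∑ m ∈ Finset.range n,
      ((n - m - 1).factorial : ℝ) / (m.factorial : ℝ) * (x / 2) ^ (2 * (m : ℤ) - n)
    + (2 / π) * Real.log (x / 2) * besselJ n x
    - (1 / π) * ∑' m : ℕ, (digammaSucc m + digammaSucc (n + m)) *
        ((-1) ^ m / ((m.factorial : ℝ) * ((n + m).factorial : ℝ))) * (x / 2) ^ (2 * m + n)

/-- The two kinds of Hankel function; they correspond to the upper and the lower sign. -/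
inductive HankelKind
  | first
  | second

/-- The sign `±`: `1` for the first kind, `-1` for the second. -/
def HankelKind.sign : HankelKind → ℂ
  | .first => 1
  | .second => -1

/-- Hankel functions `H_n^{(1,2)} = J_n ± i Y_n`. -/
def hankel (κ : HankelKind) (n : ℕ) (x : ℝ) : ℂ :=
  (besselJ n x : ℂ) + κ.sign * Complex.I * (besselY n x : ℂ)

/-- Struve function of integer order `ν`. -/
def struve (ν : ℤ) (x : ℝ) : ℝ :=
  ∑' m : ℕ, (-1) ^ m / (Real.Gamma (m + 3 / 2) * Real.Gamma (m + ν + 3 / 2)) *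
    (x / 2) ^ (2 * (m : ℤ) + ν + 1)

/-! ### Cauchy principal values -/

/-- Cauchy principal value of `∫_a^b f`, where `ρ x` is the distance of the point with parameter
`x` from the singularity: the limit as `ε → 0⁺` of the integral over the part where `ρ > ε`. -/
def pvIntegral (a b : ℝ) (ρ : ℝ → ℝ) (f : ℝ → ℂ) : ℂ :=
  limUnder (𝓝[>] (0 : ℝ)) fun ε => ∫ x in {x | x ∈ Icc a b ∧ ε < ρ x}, f x

/-- The principal value exists: all truncated integrals converge, and so does their limit. -/
def PVConverges (a b : ℝ) (ρ : ℝ → ℝ) (f : ℝ → ℂ) : Prop :=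
  (∀ ε > 0, IntegrableOn f {x | x ∈ Icc a b ∧ ε < ρ x}) ∧
  ∃ v : ℂ, Tendsto (fun ε => ∫ x in {x | x ∈ Icc a b ∧ ε < ρ x}, f x) (𝓝[>] (0 : ℝ)) (𝓝 v)

/-! ### Segments and hat functions -/

/-- The two extrema of an oriented segment: `A` (local index 1) and `B` (local index 2). -/
inductive Endpoint
  | A
  | B
  deriving DecidableEq

instance : Fintype Endpoint := ⟨{.A, .B}, by rintro (_ | _) <;> simp⟩

/-- Linear shape functions in the local variable `t ∈ [0, 1]`: `1 - t` for `A`, `t` for `B`. -/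
def shape : Endpoint → ℝ → ℝ
  | .A, t => 1 - t
  | .B, t => t

/-- The plane with its Euclidean norm. -/
abbrev Plane := EuclideanSpace ℝ (Fin 2)

/-- A nondegenerate oriented segment with extrema `r_A`, `r_B`. -/
structure Segment where
  rA : Plane
  rB : Plane
  ne : rA ≠ rB

namespace Segment

def length (S : Segment) : ℝ := dist S.rA S.rB

/-- The point of the segment at arc length `x` from `r_A`. -/
def point (S : Segment) (x : ℝ) : Plane := S.rA + (x / S.length) • (S.rB - S.rA)

/-- Unit normal `(y_B - y_A, x_A - x_B) / l`. -/
def normal (S : Segment) : Plane :=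
  (1 / S.length) • !₂[S.rB 1 - S.rA 1, S.rA 0 - S.rB 0]

/-- The hat functions of the segment, extended to the plane constantly along the normal. -/
def hat (S : Segment) (a : Endpoint) (r : Plane) : ℝ :=
  shape a (1 / S.length ^ 2 * inner ℝ (r - S.rA) (S.rB - S.rA))

theorem length_pos (S : Segment) : 0 < S.length := dist_pos.2 S.ne

/-- On the segment the hat functions are the linear shape functions. -/
theorem hat_point (S : Segment) (a : Endpoint) (x : ℝ) :
    S.hat a (S.point x) = shape a (x / S.length) := by
  have h : S.length ≠ 0 := S.length_pos.ne'
  have h2 : inner ℝ (S.rB - S.rA) (S.rB - S.rA) = S.length ^ 2 := by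
    rw [real_inner_self_eq_norm_sq, length, dist_comm, dist_eq_norm]
  have h3 : S.point x - S.rA = (x / S.length) • (S.rB - S.rA) := by simp [point]
  rw [hat, h3, real_inner_smul_left, h2]
  congr 1
  field_simp

/-- Arc-length integral over the segment. -/
def integral (S : Segment) (f : Plane → ℂ) : ℂ := ∫ x in (0 : ℝ)..S.length, f (S.point x)

/-- Arc-length integral over the segment, as a Cauchy principal value at the point `r`. -/
def pv (S : Segment) (r : Plane) (f : Plane → ℂ) : ℂ :=
  pvIntegral 0 S.length (fun x => dist r (S.point x)) (fun x => f (S.point x))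

/-- The iterated integral `∫_S dr ⨍_T dr' F(r, r')` is well defined. -/
def DoubleConverges (S T : Segment) (F : Plane → Plane → ℂ) : Prop :=
  (∀ x ∈ Icc 0 S.length,
    PVConverges 0 T.length (fun x' => dist (S.point x) (T.point x'))
      (fun x' => F (S.point x) (T.point x'))) ∧
  IntervalIntegrable (fun x => T.pv (S.point x) (F (S.point x))) volume 0 S.length

end Segment

/-- `curl_S f = n_x ∂f/∂y - n_y ∂f/∂x` for the normal `n`. -/
def curlS (n : Plane) (f : Plane → ℝ) (r : Plane) : ℝ :=
  n 0 * fderiv ℝ f r (EuclideanSpace.single 1 1) - n 1 * fderiv ℝ f r (EuclideanSpace.single 0 1)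

/-! ### The variational hypersingular matrix -/

/-- Helmholtz kernel `g(r, r') = (i/4) H_0^{(1,2)}(k |r - r'|)`. -/
def green (κ : HankelKind) (k : ℝ) (r r' : Plane) : ℂ :=
  Complex.I / 4 * hankel κ 0 (k * dist r r')

/-- Integrand of the variational form of the hypersingular operator for the hat functions of the
vertex `a` of `S` and the vertex `b` of `T`. -/
def variationalKernel (κ : HankelKind) (k : ℝ) (S T : Segment) (a b : Endpoint)
    (r r' : Plane) : ℂ :=
  green κ k r r' *
    ((k ^ 2 * inner ℝ S.normal T.normal * S.hat a r * T.hat b r'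
      - curlS S.normal (S.hat a) r * curlS T.normal (T.hat b) r' : ℝ) : ℂ)

/-- Contribution of the pair `(S, T)`, with the vertices `a`, `b`, to the matrix. -/
def elementTerm (κ : HankelKind) (k : ℝ) (S T : Segment) (a b : Endpoint) : ℂ :=
  S.integral fun r => T.pv r (variationalKernel κ k S T a b r)

/-- `Υ̃_ab`: the contribution of a segment paired with itself. -/
def upsilonTilde (κ : HankelKind) (k : ℝ) (S : Segment) (a b : Endpoint) : ℂ :=
  elementTerm κ k S S a b

/-- A mesh of segments: nodes indexed by `V`, elements indexed by `E`. -/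
structure Mesh (V E : Type*) where
  node : V → Plane
  vertex : E → Endpoint → V
  ne : ∀ n, node (vertex n .A) ≠ node (vertex n .B)

/-- The `n`-th segment of the mesh. -/
def Mesh.segment {V E : Type*} (M : Mesh V E) (n : E) : Segment :=
  ⟨M.node (M.vertex n .A), M.node (M.vertex n .B), M.ne n⟩

open Classical in
/-- The elements that have the node `i` as a vertex, each with the place of `i` in it. -/
def Mesh.star {V E : Type*} [Fintype E] (M : Mesh V E) (i : V) : Finset (E × Endpoint) :=
  Finset.univ.filter fun p => M.vertex p.1 p.2 = i

/-- The variational hypersingular matrix `N_ij`. -/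
def Mesh.hypersingular {V E : Type*} [Fintype E] (M : Mesh V E) (κ : HankelKind) (k : ℝ)
    (i j : V) : ℂ :=
  ∑ p ∈ M.star i, ∑ q ∈ M.star j,
    elementTerm κ k (M.segment p.1) (M.segment q.1) p.2 q.2

/-! ### Single layer integrals over coincident elements -/

/-- Integrand of the single layer integral in the local frame. -/
def singleKernel (κ : HankelKind) (k l : ℝ) (a b : Endpoint) (x x' : ℝ) : ℂ :=
  hankel κ 0 (k * |x'|) * ((shape a (x / l) * shape b ((x' + x) / l) : ℝ) : ℂ)

/-- `I_ab = (i/4) ∫_0^l dx ⨍_{-x}^{l-x} dx' H_0(k|x'|) p_a(x) p_b(x' + x)`. -/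
def singleI (κ : HankelKind) (k l : ℝ) (a b : Endpoint) : ℂ :=
  Complex.I / 4 * ∫ x in (0 : ℝ)..l,
    pvIntegral (-x) (l - x) (fun x' => |x'|) (singleKernel κ k l a b x)

/-- The iterated integral that defines `I_ab` is well defined. -/
def SingleConverges (κ : HankelKind) (k l : ℝ) (a b : Endpoint) : Prop :=
  (∀ x ∈ Icc 0 l,
    PVConverges (-x) (l - x) (fun x' => |x'|) (singleKernel κ k l a b x)) ∧
  IntervalIntegrable
    (fun x => pvIntegral (-x) (l - x) (fun x' => |x'|) (singleKernel κ k l a b x)) volume 0 l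

/-- `𝓘_0(σ) = ∫_0^σ H_0(x) dx`. -/
def hankelInt (κ : HankelKind) (σ : ℝ) : ℂ := ∫ x in (0 : ℝ)..σ, hankel κ 0 x

/-- `Γ_0(σ) = ∫_0^σ 𝓘_0(x) dx`. -/
def gammaZero (κ : HankelKind) (σ : ℝ) : ℂ := ∫ x in (0 : ℝ)..σ, hankelInt κ x

/-- `Γ_2(σ) = ∫_0^σ 𝓘_0(x) x (x - σ) dx`. -/
def gammaTwo (κ : HankelKind) (σ : ℝ) : ℂ :=
  ∫ x in (0 : ℝ)..σ, hankelInt κ x * ((x * (x - σ) : ℝ) : ℂ)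

/-- `H_0(x) 𝐇_{-1}(x) + H_1(x) 𝐇_0(x)`. -/
def hankelStruve (κ : HankelKind) (x : ℝ) : ℂ :=
  hankel κ 0 x * (struve (-1) x : ℂ) + hankel κ 1 x * (struve 0 x : ℂ)

end HelmholtzBEM

end

open HelmholtzBEM

/-! ### Entire power series with factorially decaying coefficients -/

/-! On a coincident pair everything is one-dimensional: the distance is `|x - y|`, the normals have
inner product 1, the curls are constants `±1/l`, and the hat functions are affine in arc length. So
every kernel involved is `h |x - y|` times a polynomial bilinear in `x`, `y`, with `h w = H_0(k w)`.
Since `H_0` has only a logarithmic singularity, each principal value is an ordinary integral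
(`tendsto_truncated_integral`).

For such a kernel the double integral is elementary (`integral_integral_kernel`). Splitting the
inner integral at `y = x` produces the moments `∫_0^x w^n h`; reflecting `x ↦ l - x` and integrating
by parts leaves only the full moments of orders 0, 1 and 3. `Υ̃_ab` and `I_ab` both have this form,
and after the factor `k^2` they differ only in the constant coefficient, which contributes a
multiple of `Γ_0`.

It remains to express moments of `H_0` by special functions. `Γ_0` and `Γ_2` are themselves
combinations of moments, by parts. The moments of orders 2 and 3 have explicit antiderivatives built
from `x H_1` and `x^2 H_2`, and the moment of order 0 one built from Struve functions. The `±`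
constant of the final formula is the limit of `x^2 H_2` at `0⁺`.

The rules `H_0' = -H_1`, `(x H_1)' = x H_0`, `(x^2 H_2)' = x^2 H_1` and their Struve analogues are
proved from the defining series: each is a monomial times a power series in `(x/2)^2` (plus
logarithm and polar terms for `Y_n`), and the rules become identities between coefficients. -/

/-- The power series with coefficients `c`. -/
noncomputable def powSer (c : ℕ → ℝ) (z : ℝ) : ℝ := ∑' m, c m * z ^ m

/-- Coefficients dominated by those of an exponential. -/
def FactorialDecay (c : ℕ → ℝ) : Prop := ∃ C A : ℝ, ∀ m, |c m| ≤ C * (A ^ m / m.factorial)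

/-- Coefficients of the derivative. -/
def derivCoeff (c : ℕ → ℝ) (m : ℕ) : ℝ := (m + 1) * c (m + 1)

theorem FactorialDecay.summable_abs {c : ℕ → ℝ} (h : FactorialDecay c) (z : ℝ) :
    Summable fun m => |c m| * |z| ^ m := by
  obtain ⟨C, A, h⟩ := h
  refine Summable.of_nonneg_of_le (fun m => by positivity) (fun m => ?_)
    ((Real.summable_pow_div_factorial (A * |z|)).mul_left C)
  calc |c m| * |z| ^ m ≤ C * (A ^ m / m.factorial) * |z| ^ m := by gcongr; exact h m
    _ = C * ((A * |z|) ^ m / m.factorial) := by rw [mul_pow]; ring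

theorem FactorialDecay.summable {c : ℕ → ℝ} (h : FactorialDecay c) (z : ℝ) :
    Summable fun m => c m * z ^ m := by
  refine Summable.of_norm ?_
  simpa [abs_mul, abs_pow] using h.summable_abs z

theorem FactorialDecay.derivCoeff {c : ℕ → ℝ} (h : FactorialDecay c) :
    FactorialDecay (derivCoeff c) := by
  obtain ⟨C, A, h⟩ := h
  refine ⟨C * A, A, fun m => ?_⟩
  have h1 := h (m + 1)
  rw [_root_.derivCoeff, abs_mul, abs_of_pos (by positivity : (0 : ℝ) < m + 1)]
  calc ((m : ℝ) + 1) * |c (m + 1)|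
      ≤ (m + 1) * (C * (A ^ (m + 1) / (m + 1).factorial)) := by gcongr
    _ = C * A * (A ^ m / m.factorial) := by
      rw [Nat.factorial_succ, pow_succ]; push_cast; field_simp

/-- Geometric growth is absorbed by the base `A`. With `m + 1 ≤ 2 ^ m` this also covers factors that
are polynomial in `m`. -/
theorem FactorialDecay.of_abs_le {c d : ℕ → ℝ} (h : FactorialDecay c) (B : ℝ)
    (hd : ∀ m, |d m| ≤ B ^ m * |c m|) (hB : 0 ≤ B) : FactorialDecay d := by
  obtain ⟨C, A, h⟩ := h
  refine ⟨C, B * A, fun m => (hd m).trans ?_⟩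
  calc B ^ m * |c m| ≤ B ^ m * (C * (A ^ m / m.factorial)) := by gcongr; exact h m
    _ = _ := by rw [mul_pow]; ring

theorem FactorialDecay.const_mul {c : ℕ → ℝ} (h : FactorialDecay c) (a : ℝ) :
    FactorialDecay fun m => a * c m := by
  obtain ⟨C, A, h⟩ := h
  refine ⟨|a| * C, A, fun m => ?_⟩
  rw [abs_mul, mul_assoc]
  gcongr
  exact h m

theorem natCast_add_one_le_two_pow (m : ℕ) : (m : ℝ) + 1 ≤ 2 ^ m := by
  exact_mod_cast Nat.lt_two_pow_self (n := m)

theorem FactorialDecay.linear_mul {c : ℕ → ℝ} (h : FactorialDecay c) {a : ℝ} (ha : 0 ≤ a) :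
    FactorialDecay fun m => (m + a) * c m := by
  refine (h.const_mul (1 + a)).of_abs_le 2 (fun m => ?_) (by norm_num)
  have h1 := natCast_add_one_le_two_pow m
  rw [abs_mul, abs_mul, abs_of_nonneg (by positivity : (0 : ℝ) ≤ m + a),
    abs_of_nonneg (by positivity : 0 ≤ 1 + a), ← mul_assoc]
  gcongr
  nlinarith [(Nat.cast_nonneg m : (0 : ℝ) ≤ m)]

theorem FactorialDecay.add {c d : ℕ → ℝ} (hc : FactorialDecay c) (hd : FactorialDecay d) :
    FactorialDecay fun m => c m + d m := by
  obtain ⟨C, A, hc⟩ := hc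
  obtain ⟨D, B, hd⟩ := hd
  refine ⟨|C| + |D|, |A| + |B|, fun m => (abs_add_le _ _).trans ?_⟩
  rw [add_mul]
  have key : ∀ C' A' : ℝ, |A'| ≤ |A| + |B| →
      C' * (A' ^ m / m.factorial) ≤ |C'| * ((|A| + |B|) ^ m / m.factorial) := by
    intro C' A' hA
    refine (le_abs_self _).trans ?_
    rw [abs_mul, abs_div, abs_pow, Nat.abs_cast]
    gcongr
  exact add_le_add ((hc m).trans (key _ _ (by simp))) ((hd m).trans (key _ _ (by simp)))

theorem powSer_add {c d : ℕ → ℝ} (hc : FactorialDecay c) (hd : FactorialDecay d) (z : ℝ) :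
    powSer (fun m => c m + d m) z = powSer c z + powSer d z := by
  simp only [powSer, add_mul]
  exact (hc.summable z).tsum_add (hd.summable z)

theorem powSer_const_mul (c : ℕ → ℝ) (a z : ℝ) :
    powSer (fun m => a * c m) z = a * powSer c z := by
  simp only [powSer, mul_assoc, tsum_mul_left]

theorem powSer_eq_add_mul {c : ℕ → ℝ} (h : FactorialDecay c) (z : ℝ) :
    powSer c z = c 0 + z * powSer (fun m => c (m + 1)) z := by
  rw [powSer, (h.summable z).tsum_eq_zero_add, powSer, ← tsum_mul_left]
  simp only [pow_zero, mul_one, pow_succ]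
  congr 1
  exact tsum_congr fun m => by ring

/-- Multiplying the coefficients by `m` is the Euler operator `z d/dz`. This turns coefficient
recurrences between neighbouring orders into differential relations. -/
theorem powSer_linear_mul {c : ℕ → ℝ} (h : FactorialDecay c) (a z : ℝ) :
    powSer (fun m => (m + a) * c m) z = a * powSer c z + z * powSer (derivCoeff c) z := by
  have h0 : FactorialDecay fun m => ((m : ℝ) + 0) * c m := h.linear_mul le_rfl
  have h1 : powSer (fun m => ((m : ℝ) + 0) * c m) z = z * powSer (derivCoeff c) z := by
    rw [powSer_eq_add_mul h0]
    simp [derivCoeff, powSer]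
  rw [← h1, ← powSer_const_mul, ← powSer_add (h.const_mul a) h0]
  congr 1
  ext m
  ring

theorem hasDerivAt_powSer {c : ℕ → ℝ} (h : FactorialDecay c) (z : ℝ) :
    HasDerivAt (powSer c) (powSer (derivCoeff c) z) z := by
  -- Majorant of the differentiated terms, uniform on the ball of radius `|z| + 1`.
  have hu : Summable fun m : ℕ => |c m| * (m * (|z| + 1) ^ (m - 1)) := by
    refine (summable_nat_add_iff 1).1 ?_
    refine (h.derivCoeff.summable_abs (|z| + 1)).congr fun m => ?_
    rw [derivCoeff, abs_mul, abs_of_pos (by positivity : (0 : ℝ) < m + 1),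
      abs_of_pos (by positivity : (0 : ℝ) < |z| + 1)]
    simp only [Nat.add_sub_cancel]
    push_cast
    ring
  have h1 := hasDerivAt_tsum_of_isPreconnected (𝕜 := ℝ) (F := ℝ)
    (g := fun m z => c m * z ^ m) (g' := fun m z => c m * (m * z ^ (m - 1)))
    (t := Metric.ball 0 (|z| + 1)) (y₀ := z) (y := z) hu Metric.isOpen_ball
    (convex_ball _ _).isPreconnected
    (fun m y _ => (hasDerivAt_pow m y).const_mul (c m))
    (fun m y hy => by
      rw [norm_mul, norm_mul, norm_pow, Real.norm_natCast, Real.norm_eq_abs, Real.norm_eq_abs]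
      have : |y| ≤ |z| + 1 := by simpa using (mem_ball_zero_iff.1 hy).le
      gcongr)
    (by simp) (h.summable z) (by simp)
  refine h1.congr_deriv ?_
  have hs : Summable fun m : ℕ => c m * (m * z ^ (m - 1)) := by
    refine Summable.of_norm_bounded hu fun m => ?_
    rw [norm_mul, norm_mul, norm_pow, Real.norm_natCast, Real.norm_eq_abs, Real.norm_eq_abs]
    gcongr
    linarith
  rw [hs.tsum_eq_zero_add, powSer]
  simp only [Nat.cast_zero, zero_mul, mul_zero, zero_add, derivCoeff]
  exact tsum_congr fun m => by simp only [Nat.add_sub_cancel]; push_cast; ring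

theorem continuous_powSer {c : ℕ → ℝ} (h : FactorialDecay c) : Continuous (powSer c) :=
  continuous_iff_continuousAt.2 fun z => (hasDerivAt_powSer h z).continuousAt

/-- Derivative of a power series in `(x / 2) ^ 2`. -/
theorem hasDerivAt_powSer_sq {c : ℕ → ℝ} (h : FactorialDecay c) (x : ℝ) :
    HasDerivAt (fun x => powSer c ((x / 2) ^ 2)) (powSer (derivCoeff c) ((x / 2) ^ 2) * (x / 2))
      x := by
  have h1 : HasDerivAt (fun x : ℝ => (x / 2) ^ 2) (x / 2) x := by
    have := ((hasDerivAt_id x).div_const 2).pow 2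
    refine this.congr_deriv ?_
    simp only [id]
    push_cast
    ring
  exact HasDerivAt.comp x (hasDerivAt_powSer h _) h1

theorem continuous_powSer_sq {c : ℕ → ℝ} (h : FactorialDecay c) :
    Continuous fun x : ℝ => powSer c ((x / 2) ^ 2) :=
  (continuous_powSer h).comp (by fun_prop)

/-! ### Bessel functions -/

/-- Coefficients of `(x / 2) ^ (-n) * J_n` as a power series in `(x / 2) ^ 2`. -/
noncomputable def coeffJ (n m : ℕ) : ℝ := (-1) ^ m / ((m.factorial : ℝ) * ((m + n).factorial : ℝ))

/-- Coefficients of the power series part of `Y_n`. -/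
noncomputable def coeffY (n m : ℕ) : ℝ := (digammaSucc m + digammaSucc (n + m)) * coeffJ n m

theorem abs_coeffJ (n m : ℕ) :
    |coeffJ n m| = 1 / ((m.factorial : ℝ) * ((m + n).factorial : ℝ)) := by
  rw [coeffJ, abs_div, abs_pow, abs_neg, abs_one, one_pow, abs_of_pos]
  positivity

theorem factorialDecay_coeffJ (n : ℕ) : FactorialDecay (coeffJ n) := by
  refine ⟨1, 1, fun m => ?_⟩
  rw [abs_coeffJ, one_pow, one_mul]
  have : (1 : ℝ) ≤ (m + n).factorial := by exact_mod_cast Nat.factorial_pos _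
  gcongr
  exact le_mul_of_one_le_right (by positivity) this

theorem digammaSucc_succ (m : ℕ) : digammaSucc (m + 1) = digammaSucc m + 1 / (m + 1) := by
  simp only [digammaSucc, harmonic_succ]
  push_cast
  ring

/-- A crude linear bound suffices, as it is dominated by `2 ^ m`. The numerical bounds on Euler's
constant serve the base case. -/
theorem abs_digammaSucc_le (m : ℕ) : |digammaSucc m| ≤ m + 1 := by
  induction m with
  | zero =>
    have h1 := Real.eulerMascheroniConstant_lt_two_thirds
    have h2 := Real.one_half_lt_eulerMascheroniConstant
    simp only [digammaSucc, harmonic_zero, abs_le]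
    constructor <;> push_cast <;> linarith
  | succ m ih =>
    rw [digammaSucc_succ]
    have h1 : (1 : ℝ) / (m + 1) ≤ 1 := by
      rw [div_le_one (by positivity)]; linarith [(Nat.cast_nonneg m : (0 : ℝ) ≤ m)]
    have h2 : (0 : ℝ) ≤ 1 / (m + 1) := by positivity
    refine (abs_add_le _ _).trans ?_
    rw [abs_of_nonneg h2]
    push_cast
    linarith

theorem factorialDecay_coeffY (n : ℕ) : FactorialDecay (coeffY n) := by
  refine ((factorialDecay_coeffJ n).const_mul (n + 2)).of_abs_le 2 (fun m => ?_) (by norm_num)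
  have h1 := natCast_add_one_le_two_pow m
  rw [coeffY, abs_mul, abs_mul, ← mul_assoc, abs_of_nonneg (by positivity : (0 : ℝ) ≤ n + 2)]
  gcongr
  refine (abs_add_le _ _).trans ?_
  have h2 := abs_digammaSucc_le m
  have h3 := abs_digammaSucc_le (n + m)
  push_cast at h3
  nlinarith [(Nat.cast_nonneg m : (0 : ℝ) ≤ m), (Nat.cast_nonneg n : (0 : ℝ) ≤ n)]

/-! ### Recurrences between neighbouring orders -/

theorem coeffJ_succ_left (n m : ℕ) : coeffJ n m = (m + n + 1) * coeffJ (n + 1) m := by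
  rw [coeffJ, coeffJ, ← Nat.add_assoc, Nat.factorial_succ]
  push_cast
  field_simp

theorem derivCoeff_coeffJ (n m : ℕ) : derivCoeff (coeffJ n) m = -coeffJ (n + 1) m := by
  rw [derivCoeff, coeffJ, coeffJ, Nat.add_right_comm m 1 n, ← Nat.add_assoc m n 1,
    Nat.factorial_succ m, pow_succ]
  push_cast
  field_simp

/-- The extra `coeffJ` comes from the increment `1 / (n + m + 1)` of digamma; it cancels the
derivative of the logarithm in `Y_{n+1}`. -/
theorem coeffY_succ_left (n m : ℕ) :
    coeffJ (n + 1) m + coeffY n m = (m + n + 1) * coeffY (n + 1) m := by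
  rw [coeffY, coeffY, coeffJ_succ_left n m, Nat.add_right_comm n 1 m, digammaSucc_succ]
  push_cast
  have : (n : ℝ) + m + 1 ≠ 0 := by positivity
  field_simp
  ring

theorem derivCoeff_coeffY_zero (m : ℕ) :
    derivCoeff (coeffY 0) m = coeffJ 0 (m + 1) - coeffY 1 m := by
  have h1 : coeffJ 1 m = -((m + 1) * coeffJ 0 (m + 1)) := by
    have := derivCoeff_coeffJ 0 m
    rw [derivCoeff] at this
    rw [this, neg_neg]
  have h2 : (m : ℝ) + 1 ≠ 0 := by positivity
  rw [derivCoeff, coeffY, coeffY, h1, zero_add, Nat.add_comm 1 m, digammaSucc_succ]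
  field_simp
  ring

theorem powSer_coeffJ_succ (n : ℕ) (z : ℝ) :
    powSer (coeffJ n) z
      = (n + 1) * powSer (coeffJ (n + 1)) z + z * powSer (derivCoeff (coeffJ (n + 1))) z := by
  rw [← powSer_linear_mul (factorialDecay_coeffJ _)]
  congr 1
  ext m
  rw [coeffJ_succ_left]
  ring

theorem powSer_coeffY_succ (n : ℕ) (z : ℝ) :
    powSer (coeffJ (n + 1)) z + powSer (coeffY n) z
      = (n + 1) * powSer (coeffY (n + 1)) z + z * powSer (derivCoeff (coeffY (n + 1))) z := by
  rw [← powSer_linear_mul (factorialDecay_coeffY _),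
    ← powSer_add (factorialDecay_coeffJ _) (factorialDecay_coeffY _)]
  congr 1
  ext m
  rw [coeffY_succ_left]
  ring

theorem powSer_derivCoeff_coeffJ (n : ℕ) (z : ℝ) :
    powSer (derivCoeff (coeffJ n)) z = -powSer (coeffJ (n + 1)) z := by
  have h : derivCoeff (coeffJ n) = fun m => (-1) * coeffJ (n + 1) m := by
    ext m; rw [derivCoeff_coeffJ]; ring
  rw [h, powSer_const_mul]
  ring

/-- In order 0 both digamma terms shift, which yields the series of `J_0` without its constant term.
The missing `1` becomes the polar term of `Y_1`. -/
theorem mul_powSer_derivCoeff_coeffY_zero (z : ℝ) :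
    z * powSer (derivCoeff (coeffY 0)) z = powSer (coeffJ 0) z - 1 - z * powSer (coeffY 1) z := by
  have h : (fun m => coeffJ 0 (m + 1)) = fun m => derivCoeff (coeffY 0) m + coeffY 1 m := by
    ext m; rw [derivCoeff_coeffY_zero]; ring
  rw [powSer_eq_add_mul (factorialDecay_coeffJ 0), h,
    powSer_add (factorialDecay_coeffY 0).derivCoeff (factorialDecay_coeffY 1)]
  simp [coeffJ]
  ring

theorem besselJ_eq (n : ℕ) (x : ℝ) :
    besselJ n x = (x / 2) ^ n * powSer (coeffJ n) ((x / 2) ^ 2) := by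
  rw [besselJ, powSer, ← tsum_mul_left]
  refine tsum_congr fun m => ?_
  rw [coeffJ, pow_add, pow_mul]
  ring

theorem besselY_eq (n : ℕ) (x : ℝ) :
    besselY n x = -(1 / π) * ∑ m ∈ Finset.range n,
        ((n - m - 1).factorial : ℝ) / (m.factorial : ℝ) * (x / 2) ^ (2 * (m : ℤ) - n)
      + (2 / π) * Real.log (x / 2) * besselJ n x
      - (1 / π) * ((x / 2) ^ n * powSer (coeffY n) ((x / 2) ^ 2)) := by
  rw [besselY, powSer, ← tsum_mul_left (a := (x / 2) ^ n)]
  refine congrArg₂ (· - ·) rfl (congrArg _ (tsum_congr fun m => ?_))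
  rw [coeffY, coeffJ, pow_add, pow_mul, Nat.add_comm m n]
  ring

theorem besselY_zero_eq (x : ℝ) :
    besselY 0 x = (2 / π) * Real.log (x / 2) * besselJ 0 x
      - (1 / π) * powSer (coeffY 0) ((x / 2) ^ 2) := by
  simp [besselY_eq]

/-- The factor `x` clears the pole of `Y_1`, as `x ^ 2` does for `Y_2` below; what is left can be
differentiated and has a limit at `0⁺`. -/
theorem mul_besselY_one_eq {x : ℝ} (hx : x ≠ 0) :
    x * besselY 1 x = -(2 / π) + (2 / π) * Real.log (x / 2) * (x * besselJ 1 x)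
      - (1 / π) * (x ^ 2 / 2 * powSer (coeffY 1) ((x / 2) ^ 2)) := by
  have : (x / 2) ^ (2 * ((0 : ℕ) : ℤ) - (1 : ℕ)) = 2 / x := by
    simp
  rw [besselY_eq, Finset.sum_range_one, this]
  simp only [Nat.sub_zero, Nat.sub_self, Nat.factorial_zero, Nat.cast_one]
  field_simp

theorem sq_mul_besselY_two_eq {x : ℝ} (hx : x ≠ 0) :
    x ^ 2 * besselY 2 x = -((4 + x ^ 2) / π) + (2 / π) * Real.log (x / 2) * (x ^ 2 * besselJ 2 x)
      - (1 / π) * (x ^ 4 / 4 * powSer (coeffY 2) ((x / 2) ^ 2)) := by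
  have h0 : (x / 2) ^ (2 * ((0 : ℕ) : ℤ) - (2 : ℕ)) = 4 / x ^ 2 := by
    have : 2 * ((0 : ℕ) : ℤ) - (2 : ℕ) = -(2 : ℕ) := by norm_num
    rw [this, zpow_neg, zpow_natCast]
    field_simp
    norm_num
  have h1 : (x / 2) ^ (2 * ((1 : ℕ) : ℤ) - (2 : ℕ)) = 1 := by simp
  rw [besselY_eq, Finset.sum_range_succ, Finset.sum_range_one, h0, h1]
  simp only [Nat.factorial]
  push_cast
  field_simp
  ring

/-! ### Derivatives of the Bessel functions -/

theorem hasDerivAt_besselJ_zero (x : ℝ) : HasDerivAt (besselJ 0) (-besselJ 1 x) x := by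
  have h : besselJ 0 = fun x => powSer (coeffJ 0) ((x / 2) ^ 2) := by
    ext x; simp [besselJ_eq]
  rw [h]
  refine HasDerivAt.congr_deriv (hasDerivAt_powSer_sq (factorialDecay_coeffJ 0) x) ?_
  rw [besselJ_eq, powSer_derivCoeff_coeffJ]
  ring

theorem hasDerivAt_mul_besselJ_one (x : ℝ) :
    HasDerivAt (fun x => x * besselJ 1 x) (x * besselJ 0 x) x := by
  have h : (fun x => x * besselJ 1 x) = fun x => x ^ 2 / 2 * powSer (coeffJ 1) ((x / 2) ^ 2) := by
    ext x; rw [besselJ_eq]; ring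
  rw [h]
  refine HasDerivAt.congr_deriv (((hasDerivAt_pow 2 x).div_const 2).mul
    (hasDerivAt_powSer_sq (factorialDecay_coeffJ 1) x)) ?_
  rw [besselJ_eq, powSer_coeffJ_succ 0]
  push_cast
  ring

theorem hasDerivAt_sq_mul_besselJ_two (x : ℝ) :
    HasDerivAt (fun x => x ^ 2 * besselJ 2 x) (x ^ 2 * besselJ 1 x) x := by
  have h : (fun x => x ^ 2 * besselJ 2 x)
      = fun x => x ^ 4 / 4 * powSer (coeffJ 2) ((x / 2) ^ 2) := by
    ext x; rw [besselJ_eq]; ring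
  rw [h]
  refine HasDerivAt.congr_deriv (((hasDerivAt_pow 4 x).div_const 4).mul
    (hasDerivAt_powSer_sq (factorialDecay_coeffJ 2) x)) ?_
  rw [besselJ_eq, powSer_coeffJ_succ 1]
  push_cast
  ring

theorem hasDerivAt_log_half {x : ℝ} (hx : x ≠ 0) :
    HasDerivAt (fun x => Real.log (x / 2)) (1 / x) x := by
  refine HasDerivAt.congr_deriv (((hasDerivAt_id x).div_const 2).log (by simpa using hx)) ?_
  simp only [id]
  field_simp

theorem hasDerivAt_besselY_zero {x : ℝ} (hx : x ≠ 0) :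
    HasDerivAt (besselY 0) (-besselY 1 x) x := by
  have h : besselY 0 = fun x => (2 / π) * Real.log (x / 2) * besselJ 0 x
      - (1 / π) * powSer (coeffY 0) ((x / 2) ^ 2) := funext besselY_zero_eq
  rw [h]
  refine HasDerivAt.congr_deriv ((((hasDerivAt_log_half hx).const_mul (2 / π)).mul
    (hasDerivAt_besselJ_zero x)).sub
    ((hasDerivAt_powSer_sq (factorialDecay_coeffY 0) x).const_mul (1 / π))) ?_
  have h1 := mul_besselY_one_eq hx
  have h2 := mul_powSer_derivCoeff_coeffY_zero ((x / 2) ^ 2)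
  have h3 := besselJ_eq 0 x
  rw [pow_zero, one_mul] at h3
  rw [← h3] at h2
  apply mul_left_cancel₀ hx
  refine Eq.symm ?_
  rw [mul_neg, h1]
  field_simp
  field_simp at h2
  linear_combination h2

theorem hasDerivAt_mul_besselY_one {x : ℝ} (hx : x ≠ 0) :
    HasDerivAt (fun x => x * besselY 1 x) (x * besselY 0 x) x := by
  have h : (fun x => x * besselY 1 x) =ᶠ[𝓝 x] fun x =>
      -(2 / π) + (2 / π) * Real.log (x / 2) * (x * besselJ 1 x)
      - (1 / π) * (x ^ 2 / 2 * powSer (coeffY 1) ((x / 2) ^ 2)) := by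
    filter_upwards [isOpen_ne.mem_nhds hx] with y hy using mul_besselY_one_eq hy
  refine HasDerivAt.congr_of_eventuallyEq ?_ h
  refine HasDerivAt.congr_deriv (((((hasDerivAt_log_half hx).const_mul (2 / π)).mul
    (hasDerivAt_mul_besselJ_one x)).const_add (-(2 / π))).sub
    ((((hasDerivAt_pow 2 x).div_const 2).mul
      (hasDerivAt_powSer_sq (factorialDecay_coeffY 1) x)).const_mul (1 / π))) ?_
  have h2 := powSer_coeffY_succ 0 ((x / 2) ^ 2)
  have h3 := besselJ_eq 1 x
  rw [besselY_zero_eq]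
  push_cast at h2 ⊢
  rw [h3]
  field_simp
  field_simp at h2
  linear_combination h2

theorem hasDerivAt_sq_mul_besselY_two {x : ℝ} (hx : x ≠ 0) :
    HasDerivAt (fun x => x ^ 2 * besselY 2 x) (x ^ 2 * besselY 1 x) x := by
  have h : (fun x => x ^ 2 * besselY 2 x) =ᶠ[𝓝 x] fun x =>
      -((4 + x ^ 2) / π) + (2 / π) * Real.log (x / 2) * (x ^ 2 * besselJ 2 x)
      - (1 / π) * (x ^ 4 / 4 * powSer (coeffY 2) ((x / 2) ^ 2)) := by
    filter_upwards [isOpen_ne.mem_nhds hx] with y hy using sq_mul_besselY_two_eq hy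
  refine HasDerivAt.congr_of_eventuallyEq ?_ h
  refine HasDerivAt.congr_deriv ((((((hasDerivAt_pow 2 x).const_add 4).div_const π).neg).add
    (((hasDerivAt_log_half hx).const_mul (2 / π)).mul
    (hasDerivAt_sq_mul_besselJ_two x))).sub
    ((((hasDerivAt_pow 4 x).div_const 4).mul
      (hasDerivAt_powSer_sq (factorialDecay_coeffY 2) x)).const_mul (1 / π))) ?_
  have h1 : x ^ 2 * besselY 1 x = x * (x * besselY 1 x) := by ring
  have h2 := powSer_coeffY_succ 1 ((x / 2) ^ 2)
  have h3 := besselJ_eq 2 x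
  rw [h1, mul_besselY_one_eq hx]
  push_cast at h2 ⊢
  rw [h3]
  field_simp
  field_simp at h2
  linear_combination x ^ 2 * h2

/-! ### Struve functions -/

/-- Coefficients of `(x / 2) ^ (-ν - 1) * 𝐇_ν` as a power series in `(x / 2) ^ 2`. -/
noncomputable def coeffStruve (ν : ℤ) (m : ℕ) : ℝ :=
  (-1) ^ m / (Real.Gamma (m + 3 / 2) * Real.Gamma (m + ν + 3 / 2))

theorem Gamma_half_add_pos (m : ℕ) : 0 < Real.Gamma (m + 1 / 2) :=
  Real.Gamma_pos_of_pos (by positivity)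

/-- Equality at `m = 0`; each step multiplies the left side by `m + 1` and the right side by the
larger `m + 3 / 2`. -/
theorem factorial_mul_Gamma_le (m : ℕ) :
    m.factorial * Real.Gamma (1 / 2) ≤ 2 * Real.Gamma (m + 3 / 2) := by
  induction m with
  | zero =>
    have := Real.Gamma_add_one (s := 1 / 2) (by norm_num)
    norm_num at this ⊢
    rw [this]; linarith
  | succ m ih =>
    have h : Real.Gamma ((m + 1 : ℕ) + 3 / 2) = (m + 3 / 2) * Real.Gamma (m + 3 / 2) := by
      rw [← Real.Gamma_add_one (by positivity)]
      congr 1; push_cast; ring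
    have h1 : 0 < Real.Gamma ((m : ℝ) + 3 / 2) := Real.Gamma_pos_of_pos (by positivity)
    rw [h, Nat.factorial_succ]
    push_cast
    nlinarith [(Nat.cast_nonneg m : (0 : ℝ) ≤ m)]

/-- Order 1 is the starting point because the coefficients of orders 0 and -1 arise from it by
linear factors, which preserve the decay. -/
theorem factorialDecay_coeffStruve_one : FactorialDecay (coeffStruve 1) := by
  have hp : 0 < Real.Gamma (1 / 2) := Real.Gamma_pos_of_pos (by norm_num)
  refine ⟨4 / Real.Gamma (1 / 2) ^ 2, 1, fun m => ?_⟩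
  have h : Real.Gamma (m + (1 : ℤ) + 3 / 2) = (m + 3 / 2) * Real.Gamma (m + 3 / 2) := by
    rw [← Real.Gamma_add_one (by positivity)]
    congr 1; push_cast; ring
  have h1 : 0 < Real.Gamma ((m : ℝ) + 3 / 2) := Real.Gamma_pos_of_pos (by positivity)
  have h2 := factorial_mul_Gamma_le m
  have h3 : (1 : ℝ) ≤ m.factorial := by exact_mod_cast Nat.factorial_pos _
  rw [coeffStruve, h, abs_div, abs_pow, abs_neg, abs_one, one_pow, abs_of_pos (by positivity),
    div_mul_div_comm, div_le_div_iff₀ (by positivity) (by positivity)]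
  have h4 : Real.Gamma (1 / 2) ≤ 2 * Real.Gamma ((m : ℝ) + 3 / 2) := by nlinarith
  have h5 : (m.factorial * Real.Gamma (1 / 2)) * Real.Gamma (1 / 2) ≤
      (2 * Real.Gamma (m + 3 / 2)) * (2 * Real.Gamma ((m : ℝ) + 3 / 2)) := by gcongr
  nlinarith [(by positivity : 0 ≤ (m : ℝ) * (Real.Gamma (m + 3 / 2)) ^ 2),
    sq_nonneg (Real.Gamma ((m : ℝ) + 3 / 2))]

theorem coeffStruve_zero (m : ℕ) : coeffStruve 0 m = (m + 3 / 2) * coeffStruve 1 m := by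
  have h : Real.Gamma (m + (1 : ℤ) + 3 / 2) = (m + 3 / 2) * Real.Gamma (m + 3 / 2) := by
    rw [← Real.Gamma_add_one (by positivity)]
    congr 1; push_cast; ring
  have h1 : 0 < Real.Gamma ((m : ℝ) + 3 / 2) := Real.Gamma_pos_of_pos (by positivity)
  rw [coeffStruve, coeffStruve, h]
  simp only [Int.cast_zero, add_zero]
  field_simp

theorem coeffStruve_neg_one (m : ℕ) : coeffStruve (-1) m = (m + 1 / 2) * coeffStruve 0 m := by
  have h : Real.Gamma (m + 3 / 2) = (m + 1 / 2) * Real.Gamma (m + 1 / 2) := by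
    rw [← Real.Gamma_add_one (by positivity)]
    congr 1; ring
  have h1 := Gamma_half_add_pos m
  have h2 : (m : ℝ) + (-1 : ℤ) + 3 / 2 = m + 1 / 2 := by push_cast; ring
  rw [coeffStruve, coeffStruve, h2]
  simp only [Int.cast_zero, add_zero]
  rw [h]
  field_simp

/-- The index shift carries the two Gamma factors of order -1 to those of order 1, in the same
order, and changes the sign; hence `𝐇_{-1} + 𝐇_1` reduces to a constant. -/
theorem coeffStruve_neg_one_succ (m : ℕ) : coeffStruve (-1) (m + 1) = -1 * coeffStruve 1 m := by
  rw [coeffStruve, coeffStruve, pow_succ]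
  have h1 : ((m + 1 : ℕ) : ℝ) + 3 / 2 = m + (1 : ℤ) + 3 / 2 := by push_cast; ring
  have h2 : ((m + 1 : ℕ) : ℝ) + (-1 : ℤ) + 3 / 2 = m + 3 / 2 := by push_cast; ring
  rw [h1, h2]
  ring

theorem coeffStruve_neg_one_zero : coeffStruve (-1) 0 = 2 / π := by
  have h := Real.Gamma_add_one (s := 1 / 2) (by norm_num)
  have h1 : (1 : ℝ) / 2 + 1 = 3 / 2 := by norm_num
  have h2 : ((0 : ℕ) : ℝ) + (-1 : ℤ) + 3 / 2 = 1 / 2 := by norm_num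
  rw [h1] at h
  rw [coeffStruve, h2, Nat.cast_zero, zero_add, h, Real.Gamma_one_half_eq, mul_assoc,
    Real.mul_self_sqrt Real.pi_pos.le]
  field_simp

theorem factorialDecay_coeffStruve_zero : FactorialDecay (coeffStruve 0) := by
  have := factorialDecay_coeffStruve_one.linear_mul (a := 3 / 2) (by norm_num)
  simpa only [← coeffStruve_zero] using this

theorem factorialDecay_coeffStruve_neg_one : FactorialDecay (coeffStruve (-1)) := by
  have := factorialDecay_coeffStruve_zero.linear_mul (a := 1 / 2) (by norm_num)
  simpa only [← coeffStruve_neg_one] using this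

theorem struve_eq (ν : ℤ) (n : ℕ) (hn : ν + 1 = n) (x : ℝ) :
    struve ν x = (x / 2) ^ n * powSer (coeffStruve ν) ((x / 2) ^ 2) := by
  rw [struve, powSer, ← tsum_mul_left]
  refine tsum_congr fun m => ?_
  have : 2 * (m : ℤ) + ν + 1 = (2 * m + n : ℕ) := by push_cast; omega
  rw [coeffStruve, this, zpow_natCast, pow_add, pow_mul]
  ring

/-- `𝐇_{-1} + 𝐇_1 = 2 / π`. -/
theorem struve_neg_one (x : ℝ) : struve (-1) x = 2 / π - struve 1 x := by
  rw [struve_eq (-1) 0 (by norm_num), struve_eq 1 2 (by norm_num),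
    powSer_eq_add_mul factorialDecay_coeffStruve_neg_one, coeffStruve_neg_one_zero]
  simp only [coeffStruve_neg_one_succ, powSer_const_mul]
  ring

theorem hasDerivAt_struve_zero (x : ℝ) : HasDerivAt (struve 0) (struve (-1) x) x := by
  have h : struve 0 = fun x => x / 2 * powSer (coeffStruve 0) ((x / 2) ^ 2) := by
    ext x; rw [struve_eq 0 1 (by norm_num), pow_one]
  rw [h]
  refine HasDerivAt.congr_deriv (((hasDerivAt_id x).div_const 2).mul
    (hasDerivAt_powSer_sq factorialDecay_coeffStruve_zero x)) ?_
  rw [struve_eq (-1) 0 (by norm_num), funext coeffStruve_neg_one,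
    powSer_linear_mul factorialDecay_coeffStruve_zero]
  simp only [id]
  ring

theorem hasDerivAt_mul_struve_one (x : ℝ) :
    HasDerivAt (fun x => x * struve 1 x) (x * struve 0 x) x := by
  have h : (fun x => x * struve 1 x)
      = fun x => x ^ 3 / 4 * powSer (coeffStruve 1) ((x / 2) ^ 2) := by
    ext x; rw [struve_eq 1 2 (by norm_num)]; ring
  rw [h]
  refine HasDerivAt.congr_deriv (((hasDerivAt_pow 3 x).div_const 4).mul
    (hasDerivAt_powSer_sq factorialDecay_coeffStruve_one x)) ?_
  rw [struve_eq 0 1 (by norm_num), funext coeffStruve_zero,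
    powSer_linear_mul factorialDecay_coeffStruve_one]
  push_cast
  ring

theorem continuous_struve_one : Continuous (struve 1) := by
  have h : struve 1 = fun x => (x / 2) ^ 2 * powSer (coeffStruve 1) ((x / 2) ^ 2) := by
    ext x; rw [struve_eq 1 2 (by norm_num)]
  rw [h]
  exact (by fun_prop : Continuous fun x : ℝ => (x / 2) ^ 2).mul
    (continuous_powSer_sq factorialDecay_coeffStruve_one)

/-! ### Hankel functions -/

theorem continuous_besselJ (n : ℕ) : Continuous (besselJ n) := by
  rw [funext (besselJ_eq n)]
  exact (by fun_prop : Continuous fun x : ℝ => (x / 2) ^ n).mul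
    (continuous_powSer_sq (factorialDecay_coeffJ n))

theorem hasDerivAt_hankel_zero (κ : HankelKind) {x : ℝ} (hx : x ≠ 0) :
    HasDerivAt (hankel κ 0) (-hankel κ 1 x) x := by
  refine HasDerivAt.congr_deriv ((hasDerivAt_besselJ_zero x).ofReal_comp.add
    ((hasDerivAt_besselY_zero hx).ofReal_comp.const_mul (κ.sign * Complex.I))) ?_
  rw [hankel]
  push_cast
  ring

theorem hasDerivAt_mul_hankel_one (κ : HankelKind) {x : ℝ} (hx : x ≠ 0) :
    HasDerivAt (fun x : ℝ => (x : ℂ) * hankel κ 1 x) (x * hankel κ 0 x) x := by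
  have h : (fun x : ℝ => (x : ℂ) * hankel κ 1 x) = fun x : ℝ =>
      ((x * besselJ 1 x : ℝ) : ℂ) + κ.sign * Complex.I * ((x * besselY 1 x : ℝ) : ℂ) := by
    ext x; rw [hankel]; push_cast; ring
  rw [h]
  refine HasDerivAt.congr_deriv ((hasDerivAt_mul_besselJ_one x).ofReal_comp.add
    ((hasDerivAt_mul_besselY_one hx).ofReal_comp.const_mul (κ.sign * Complex.I))) ?_
  rw [hankel]
  push_cast
  ring

theorem hasDerivAt_sq_mul_hankel_two (κ : HankelKind) {x : ℝ} (hx : x ≠ 0) :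
    HasDerivAt (fun x : ℝ => (x : ℂ) ^ 2 * hankel κ 2 x) (x ^ 2 * hankel κ 1 x) x := by
  have h : (fun x : ℝ => (x : ℂ) ^ 2 * hankel κ 2 x) = fun x : ℝ =>
      ((x ^ 2 * besselJ 2 x : ℝ) : ℂ) + κ.sign * Complex.I * ((x ^ 2 * besselY 2 x : ℝ) : ℂ) := by
    ext x; rw [hankel]; push_cast; ring
  rw [h]
  refine HasDerivAt.congr_deriv ((hasDerivAt_sq_mul_besselJ_two x).ofReal_comp.add
    ((hasDerivAt_sq_mul_besselY_two hx).ofReal_comp.const_mul (κ.sign * Complex.I))) ?_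
  rw [hankel]
  push_cast
  ring

/-! ### Behaviour at the origin -/

theorem continuous_mul_log_half : Continuous fun x : ℝ => x * Real.log (x / 2) := by
  have h : (fun x : ℝ => x * Real.log (x / 2)) = fun x => 2 * (x / 2 * Real.log (x / 2)) := by
    ext x; ring
  rw [h]
  exact (Real.continuous_mul_log.comp (by fun_prop : Continuous fun x : ℝ => x / 2)).const_mul 2

theorem continuous_mul_besselY_zero : Continuous fun x => x * besselY 0 x := by
  have h : (fun x => x * besselY 0 x) = fun x =>
      (2 / π) * (x * Real.log (x / 2)) * besselJ 0 x
        - (1 / π) * (x * powSer (coeffY 0) ((x / 2) ^ 2)) := by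
    ext x; rw [besselY_zero_eq]; ring
  rw [h]
  exact ((continuous_mul_log_half.const_mul _).mul (continuous_besselJ 0)).sub
    ((continuous_id.mul (continuous_powSer_sq (factorialDecay_coeffY 0))).const_mul _)

theorem tendsto_mul_besselY_one :
    Tendsto (fun x => x * besselY 1 x) (𝓝[>] 0) (𝓝 (-(2 / π))) := by
  have h : Continuous fun x => -(2 / π) + (2 / π) * (x * Real.log (x / 2)) * besselJ 1 x
      - (1 / π) * (x ^ 2 / 2 * powSer (coeffY 1) ((x / 2) ^ 2)) :=
    (((continuous_mul_log_half.const_mul _).mul (continuous_besselJ 1)).const_add _).sub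
    (((by fun_prop : Continuous fun x : ℝ => x ^ 2 / 2).mul
      (continuous_powSer_sq (factorialDecay_coeffY 1))).const_mul _)
  have h1 := (h.tendsto 0).mono_left (nhdsWithin_le_nhds (s := Ioi 0))
  simp only [zero_mul, mul_zero, add_zero, ne_eq, OfNat.ofNat_ne_zero, not_false_eq_true, zero_pow,
    zero_div, sub_zero] at h1
  refine h1.congr' ?_
  filter_upwards [self_mem_nhdsWithin] with x hx
  rw [mul_besselY_one_eq (ne_of_gt hx)]
  ring

theorem tendsto_sq_mul_besselY_two :
    Tendsto (fun x => x ^ 2 * besselY 2 x) (𝓝[>] 0) (𝓝 (-(4 / π))) := by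
  have h : Continuous fun x => -((4 + x ^ 2) / π)
      + (2 / π) * (x * Real.log (x / 2)) * (x * besselJ 2 x)
      - (1 / π) * (x ^ 4 / 4 * powSer (coeffY 2) ((x / 2) ^ 2)) :=
    ((by fun_prop : Continuous fun x : ℝ => -((4 + x ^ 2) / π)).add
      ((continuous_mul_log_half.const_mul _).mul (continuous_id.mul (continuous_besselJ 2)))).sub
    (((by fun_prop : Continuous fun x : ℝ => x ^ 4 / 4).mul
      (continuous_powSer_sq (factorialDecay_coeffY 2))).const_mul _)
  have h1 := (h.tendsto 0).mono_left (nhdsWithin_le_nhds (s := Ioi 0))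
  simp only [zero_mul, mul_zero, add_zero, ne_eq, OfNat.ofNat_ne_zero, not_false_eq_true, zero_pow,
    zero_div, sub_zero] at h1
  refine h1.congr' ?_
  filter_upwards [self_mem_nhdsWithin] with x hx
  rw [sq_mul_besselY_two_eq (ne_of_gt hx)]
  ring

theorem tendsto_ofReal_nhdsGT : Tendsto (fun x : ℝ => (x : ℂ)) (𝓝[>] 0) (𝓝 0) := by
  have := (Complex.continuous_ofReal.tendsto 0).mono_left (nhdsWithin_le_nhds (s := Ioi 0))
  simpa using this

theorem tendsto_mul_hankel_zero (κ : HankelKind) :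
    Tendsto (fun x : ℝ => (x : ℂ) * hankel κ 0 x) (𝓝[>] 0) (𝓝 0) := by
  have h : (fun x : ℝ => (x : ℂ) * hankel κ 0 x) = fun x : ℝ =>
      ((x * besselJ 0 x : ℝ) : ℂ) + κ.sign * Complex.I * ((x * besselY 0 x : ℝ) : ℂ) := by
    ext x; rw [hankel]; push_cast; ring
  have hc : Continuous (fun x : ℝ => (x : ℂ) * hankel κ 0 x) := by
    rw [h]
    exact (Complex.continuous_ofReal.comp (continuous_id.mul (continuous_besselJ 0))).add
      ((Complex.continuous_ofReal.comp continuous_mul_besselY_zero).const_mul _)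
  simpa using (hc.tendsto 0).mono_left (nhdsWithin_le_nhds (s := Ioi 0))

theorem tendsto_mul_hankel_one (κ : HankelKind) :
    Tendsto (fun x : ℝ => (x : ℂ) * hankel κ 1 x) (𝓝[>] 0)
      (𝓝 (κ.sign * Complex.I * (-(2 / π)))) := by
  have h : (fun x : ℝ => (x : ℂ) * hankel κ 1 x) = fun x : ℝ =>
      ((x * besselJ 1 x : ℝ) : ℂ) + κ.sign * Complex.I * ((x * besselY 1 x : ℝ) : ℂ) := by
    ext x; rw [hankel]; push_cast; ring
  rw [h]
  have hj := ((continuous_id.mul (continuous_besselJ 1)).tendsto 0).mono_left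
    (nhdsWithin_le_nhds (s := Ioi 0))
  simpa using hj.ofReal.add (tendsto_mul_besselY_one.ofReal.const_mul (κ.sign * Complex.I))

/-- Source of the term `±2 / (π k^4 l^2)`: this limit is the boundary value at 0 in the third
moment. -/
theorem tendsto_sq_mul_hankel_two (κ : HankelKind) :
    Tendsto (fun x : ℝ => (x : ℂ) ^ 2 * hankel κ 2 x) (𝓝[>] 0)
      (𝓝 (κ.sign * Complex.I * (-(4 / π)))) := by
  have h : (fun x : ℝ => (x : ℂ) ^ 2 * hankel κ 2 x) = fun x : ℝ =>
      ((x ^ 2 * besselJ 2 x : ℝ) : ℂ) + κ.sign * Complex.I * ((x ^ 2 * besselY 2 x : ℝ) : ℂ) := by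
    ext x; rw [hankel]; push_cast; ring
  rw [h]
  have hj := (((continuous_pow 2).mul (continuous_besselJ 2)).tendsto 0).mono_left
    (nhdsWithin_le_nhds (s := Ioi 0))
  simpa using hj.ofReal.add (tendsto_sq_mul_besselY_two.ofReal.const_mul (κ.sign * Complex.I))

theorem intervalIntegrable_hankel_zero (κ : HankelKind) (a b : ℝ) :
    IntervalIntegrable (hankel κ 0) volume a b := by
  have hlog : IntervalIntegrable (fun x : ℝ => Real.log (x / 2)) volume a b := by
    have := (intervalIntegral.intervalIntegrable_log' (a := a / 2) (b := b / 2)).comp_mul_left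
      (c := (2 : ℝ)⁻¹)
    simpa [div_eq_inv_mul] using this
  have hY : IntervalIntegrable (besselY 0) volume a b := by
    rw [funext besselY_zero_eq]
    exact ((hlog.const_mul _).mul_continuousOn (continuous_besselJ 0).continuousOn).sub
      (((continuous_powSer_sq (factorialDecay_coeffY 0)).const_mul _).intervalIntegrable _ _)
  have hJ : IntervalIntegrable (besselJ 0) volume a b := (continuous_besselJ 0).intervalIntegrable _ _
  exact IntervalIntegrable.add (f := fun x => (besselJ 0 x : ℂ))
    ⟨hJ.1.ofReal, hJ.2.ofReal⟩
    (IntervalIntegrable.const_mul (f := fun x => (besselY 0 x : ℂ)) ⟨hY.1.ofReal, hY.2.ofReal⟩ _)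

/-! ### Moments of `H_0` -/

/-- The antiderivatives below contain `Y_n`, so their value at 0 is replaced by the right limit `c`.
-/
theorem integral_eq_sub_of_tendsto_zero {F f : ℝ → ℂ} {c : ℂ} {s : ℝ} (hs : 0 < s)
    (hF : ∀ x, 0 < x → HasDerivAt F (f x) x) (hc : Tendsto F (𝓝[>] 0) (𝓝 c))
    (hf : IntervalIntegrable f volume 0 s) : ∫ x in (0 : ℝ)..s, f x = F s - c :=
  intervalIntegral.integral_eq_sub_of_hasDerivAt_of_tendsto hs (fun x hx => hF x hx.1) hf hc
    ((hF s hs).continuousAt.tendsto.mono_left nhdsWithin_le_nhds)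

theorem intervalIntegrable_pow_mul_hankel_zero (κ : HankelKind) (n : ℕ) (a b : ℝ) :
    IntervalIntegrable (fun x : ℝ => (x : ℂ) ^ n * hankel κ 0 x) volume a b :=
  (intervalIntegrable_hankel_zero κ a b).continuousOn_mul (by fun_prop)

theorem hasDerivAt_ofReal (x : ℝ) : HasDerivAt (fun x : ℝ => (x : ℂ)) 1 x :=
  (hasDerivAt_id x).ofReal_comp

/-- `∫_0^s H_0 = (π s / 2) (H_0 𝐇_{-1} + H_1 𝐇_0)`. -/
theorem hankelInt_eq (κ : HankelKind) {s : ℝ} (hs : 0 < s) :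
    hankelInt κ s = π / 2 * (s * hankelStruve κ s) := by
  have hπ : (π : ℂ) ≠ 0 := by exact_mod_cast Real.pi_ne_zero
  have hcont : Continuous fun x => (struve 1 x : ℂ) :=
    Complex.continuous_ofReal.comp continuous_struve_one
  -- In the derivative of `F` the products `H_0 𝐇_0` cancel, and `𝐇_{-1} + 𝐇_1 = 2 / π` removes the
  -- `-x H_1` left by `x H_0`; only `H_0` survives.
  have h := integral_eq_sub_of_tendsto_zero (f := hankel κ 0) (c := 0)
    (F := fun x : ℝ => x * hankel κ 0 x + π / 2 * ((x * hankel κ 1 x) * struve 0 x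
      - hankel κ 0 x * ((x * struve 1 x : ℝ) : ℂ))) hs
    (fun x hx => by
      have h0 := hasDerivAt_hankel_zero κ hx.ne'
      refine HasDerivAt.congr_deriv (((hasDerivAt_ofReal x).mul h0).add
        ((((hasDerivAt_mul_hankel_one κ hx.ne').mul (hasDerivAt_struve_zero x).ofReal_comp).sub
          (h0.mul (hasDerivAt_mul_struve_one x).ofReal_comp)).const_mul (π / 2 : ℂ))) ?_
      rw [struve_neg_one]
      push_cast
      field_simp
      ring)
    (by
      have h0 := tendsto_mul_hankel_zero κ
      have h1 := ((hasDerivAt_struve_zero 0).continuousAt.tendsto.mono_left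
        (nhdsWithin_le_nhds (s := Ioi 0))).ofReal
      have h2 := (hcont.tendsto 0).mono_left (nhdsWithin_le_nhds (s := Ioi 0))
      have h3 : struve 0 0 = 0 := by rw [struve_eq 0 1 (by norm_num)]; simp
      have := h0.add ((((tendsto_mul_hankel_one κ).mul h1).sub (h0.mul h2)).const_mul (π / 2 : ℂ))
      rw [h3] at this
      simp only [Complex.ofReal_zero, mul_zero, zero_mul, sub_zero, add_zero] at this
      refine this.congr fun x => ?_
      push_cast
      ring)
    (intervalIntegrable_hankel_zero κ 0 s)
  rw [hankelInt, h, hankelStruve, struve_neg_one]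
  push_cast
  field_simp
  ring

theorem integral_sq_mul_hankel_zero (κ : HankelKind) {s : ℝ} (hs : 0 < s) :
    ∫ x in (0 : ℝ)..s, (x : ℂ) ^ 2 * hankel κ 0 x
      = s ^ 2 * hankel κ 1 s + s * hankel κ 0 s - hankelInt κ s := by
  -- `(x^2 H_1)' = x^2 H_0 + x H_1` and `(x H_0)' = H_0 - x H_1`; the sum is free of `H_1`.
  have h := integral_eq_sub_of_tendsto_zero
    (f := fun x : ℝ => (x : ℂ) ^ 2 * hankel κ 0 x + hankel κ 0 x) (c := 0)
    (F := fun x : ℝ => x * (x * hankel κ 1 x) + x * hankel κ 0 x) hs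
    (fun x hx => by
      refine HasDerivAt.congr_deriv (((hasDerivAt_ofReal x).mul
        (hasDerivAt_mul_hankel_one κ hx.ne')).add
        ((hasDerivAt_ofReal x).mul (hasDerivAt_hankel_zero κ hx.ne'))) ?_
      ring)
    (by simpa using (tendsto_ofReal_nhdsGT.mul (tendsto_mul_hankel_one κ)).add
          (tendsto_mul_hankel_zero κ))
    ((intervalIntegrable_pow_mul_hankel_zero κ 2 0 s).add (intervalIntegrable_hankel_zero κ 0 s))
  rw [intervalIntegral.integral_add (intervalIntegrable_pow_mul_hankel_zero κ 2 0 s)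
    (intervalIntegrable_hankel_zero κ 0 s)] at h
  rw [hankelInt, eq_sub_iff_add_eq, h]
  ring

theorem integral_cube_mul_hankel_zero (κ : HankelKind) {s : ℝ} (hs : 0 < s) :
    ∫ x in (0 : ℝ)..s, (x : ℂ) ^ 3 * hankel κ 0 x
      = s ^ 3 * hankel κ 1 s - 2 * s ^ 2 * hankel κ 2 s - κ.sign * Complex.I * (8 / π) := by
  -- `(x^3 H_1)' = x^3 H_0 + 2 x^2 H_1`, and the last term is `2 (x^2 H_2)'`. The constant `c` is
  -- `-2` times the limit of `x^2 H_2`.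
  have h := integral_eq_sub_of_tendsto_zero
    (f := fun x : ℝ => (x : ℂ) ^ 3 * hankel κ 0 x) (c := κ.sign * Complex.I * (8 / π))
    (F := fun x : ℝ => x ^ 2 * (x * hankel κ 1 x) - 2 * (x ^ 2 * hankel κ 2 x)) hs
    (fun x hx => by
      refine HasDerivAt.congr_deriv ((((hasDerivAt_ofReal x).pow 2).mul
        (hasDerivAt_mul_hankel_one κ hx.ne')).sub
        ((hasDerivAt_sq_mul_hankel_two κ hx.ne').const_mul 2)) ?_
      simp only [Pi.pow_apply]
      push_cast
      ring)
    (by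
      have := ((tendsto_ofReal_nhdsGT.pow 2).mul (tendsto_mul_hankel_one κ)).sub
          ((tendsto_sq_mul_hankel_two κ).const_mul 2)
      convert this using 2
      ring)
    (intervalIntegrable_pow_mul_hankel_zero κ 3 0 s)
  rw [h]
  ring

/-! ### Principal values of integrable functions -/

/-- Dominated convergence with bound `‖f‖`: the truncation is an indicator that tends to 1 off the
null set `{c}`. -/
theorem tendsto_truncated_integral {a b c : ℝ} (hab : a ≤ b) {ρ : ℝ → ℝ} {f : ℝ → ℂ}
    (hρ : Measurable ρ) (hpos : ∀ x, x ≠ c → 0 < ρ x) (hf : IntervalIntegrable f volume a b) :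
    Tendsto (fun ε => ∫ x in {x | x ∈ Icc a b ∧ ε < ρ x}, f x) (𝓝[>] (0 : ℝ))
      (𝓝 (∫ x in a..b, f x)) := by
  have hf' : IntegrableOn f (Icc a b) := (intervalIntegrable_iff_integrableOn_Icc_of_le hab).1 hf
  have hm : ∀ ε : ℝ, MeasurableSet {x | ε < ρ x} := fun ε => measurableSet_lt measurable_const hρ
  rw [intervalIntegral.integral_of_le hab, ← integral_Icc_eq_integral_Ioc]
  have h : ∀ ε, ∫ x in {x | x ∈ Icc a b ∧ ε < ρ x}, f x
      = ∫ x in Icc a b, {x | ε < ρ x}.indicator f x := fun ε => by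
    rw [setIntegral_indicator (hm ε)]; rfl
  simp only [h]
  refine tendsto_integral_filter_of_dominated_convergence (fun x => ‖f x‖)
    (Eventually.of_forall fun ε => hf'.aestronglyMeasurable.indicator (hm ε))
    (Eventually.of_forall fun ε => Eventually.of_forall fun x => norm_indicator_le_norm_self _ _)
    hf'.norm ?_
  have hne : ∀ᵐ x ∂(volume.restrict (Icc a b)), x ≠ c :=
    ae_restrict_of_ae (by simp [ae_iff, measure_singleton])
  filter_upwards [hne] with x hx
  refine tendsto_const_nhds.congr' ?_
  filter_upwards [Ioo_mem_nhdsGT (hpos x hx)] with ε hε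
  rw [indicator_of_mem (show x ∈ {x | ε < ρ x} from hε.2)]

theorem pvConverges_of_intervalIntegrable {a b c : ℝ} (hab : a ≤ b) {ρ : ℝ → ℝ} {f : ℝ → ℂ}
    (hρ : Measurable ρ) (hpos : ∀ x, x ≠ c → 0 < ρ x) (hf : IntervalIntegrable f volume a b) :
    PVConverges a b ρ f :=
  ⟨fun _ _ => ((intervalIntegrable_iff_integrableOn_Icc_of_le hab).1 hf).mono_set fun _ hx => hx.1,
    _, tendsto_truncated_integral hab hρ hpos hf⟩

theorem pvIntegral_eq_integral {a b c : ℝ} (hab : a ≤ b) {ρ : ℝ → ℝ} {f : ℝ → ℂ}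
    (hρ : Measurable ρ) (hpos : ∀ x, x ≠ c → 0 < ρ x) (hf : IntervalIntegrable f volume a b) :
    pvIntegral a b ρ f = ∫ x in a..b, f x :=
  (tendsto_truncated_integral hab hρ hpos hf).limUnder_eq

/-! ### Double integrals of convolution kernels -/

theorem intervalIntegrable_comp_abs {h : ℝ → ℂ} (hi : ∀ a b, IntervalIntegrable h volume a b)
    (a b : ℝ) : IntervalIntegrable (fun y => h |y|) volume a b := by
  have h0 : ∀ b : ℝ, IntervalIntegrable (fun y => h |y|) volume 0 b := by
    intro b
    rcases le_total 0 b with hb | hb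
    · refine (hi 0 b).congr fun y hy => ?_
      rw [uIoc_of_le hb] at hy
      simp only [abs_of_pos hy.1]
    · have : IntervalIntegrable (fun y => h (-y)) volume 0 b := by
        simpa using (IntervalIntegrable.iff_comp_neg).1 (hi 0 (-b))
      refine this.congr fun y hy => ?_
      rw [uIoc_of_ge hb] at hy
      simp only [abs_of_nonpos hy.2]
  exact (h0 a).symm.trans (h0 b)

theorem intervalIntegrable_comp_abs_sub {h : ℝ → ℂ} (hi : ∀ a b, IntervalIntegrable h volume a b)
    (x a b : ℝ) : IntervalIntegrable (fun y => h |x - y|) volume a b := by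
  simpa using (intervalIntegrable_comp_abs hi (x - a) (x - b)).comp_sub_left x

/-- The moments `∫_0^x w ^ n h(w) dw`. -/
noncomputable def moment (h : ℝ → ℂ) (n : ℕ) (x : ℝ) : ℂ := ∫ w in (0 : ℝ)..x, (w : ℂ) ^ n * h w

theorem intervalIntegrable_pow_mul {h : ℝ → ℂ} (hi : ∀ a b, IntervalIntegrable h volume a b)
    (n : ℕ) (a b : ℝ) : IntervalIntegrable (fun w : ℝ => (w : ℂ) ^ n * h w) volume a b :=
  (hi a b).continuousOn_mul (by fun_prop)

theorem continuous_moment {h : ℝ → ℂ} (hi : ∀ a b, IntervalIntegrable h volume a b) (n : ℕ) :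
    Continuous (moment h n) :=
  intervalIntegral.continuous_primitive (intervalIntegrable_pow_mul hi n) 0

/-- Integration by parts against `x ^ (n + 1)`. Continuity of `f` is asked only on `(0, ∞)`, leaving
room for the singularity at 0; the primitive is continuous up to 0. -/
theorem integral_pow_mul_primitive {f : ℝ → ℂ} (hi : ∀ a b, IntervalIntegrable f volume a b)
    (hc : ∀ x, 0 < x → ContinuousAt f x) (n : ℕ) {l : ℝ} (hl : 0 < l) :
    ∫ x in (0 : ℝ)..l, (x : ℂ) ^ n * ∫ w in (0 : ℝ)..x, f w
      = (l ^ (n + 1) * (∫ w in (0 : ℝ)..l, f w)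
          - ∫ x in (0 : ℝ)..l, (x : ℂ) ^ (n + 1) * f x) / (n + 1) := by
  have hn : (n : ℂ) + 1 ≠ 0 := by exact_mod_cast n.succ_ne_zero
  have hmeas : AEStronglyMeasurable f (volume : Measure ℝ) := by
    have hloc : LocallyIntegrable f volume := fun x =>
      ⟨Ioc (x - 1) (x + 1), Ioc_mem_nhds (by linarith) (by linarith), (hi (x - 1) (x + 1)).1⟩
    exact hloc.aestronglyMeasurable
  have key := intervalIntegral.integral_mul_deriv_eq_deriv_mul_of_hasDerivAt (a := 0) (b := l)
    (u := fun x => ∫ w in (0 : ℝ)..x, f w) (u' := f)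
    (v := fun x : ℝ => (x : ℂ) ^ (n + 1)) (v' := fun x : ℝ => (n + 1 : ℂ) * (x : ℂ) ^ n)
    (intervalIntegral.continuous_primitive hi 0).continuousOn (by fun_prop)
    (fun x hx => by
      rw [min_eq_left hl.le] at hx
      exact intervalIntegral.integral_hasDerivAt_right (hi 0 x)
        (hmeas.stronglyMeasurableAtFilter) (hc x hx.1))
    (fun x _ => by
      refine ((hasDerivAt_ofReal x).pow (n + 1)).congr_deriv ?_
      push_cast
      simp)
    (hi 0 l) (Continuous.intervalIntegrable (by fun_prop) _ _)
  have e1 : ∀ x : ℝ, (∫ w in (0 : ℝ)..x, f w) * ((n + 1 : ℂ) * (x : ℂ) ^ n)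
      = (n + 1) * ((x : ℂ) ^ n * ∫ w in (0 : ℝ)..x, f w) := fun x => by ring
  simp only [e1, intervalIntegral.integral_const_mul, intervalIntegral.integral_same, zero_mul,
    sub_zero, mul_comm (f _)] at key
  rw [eq_div_iff hn, mul_comm, key]
  ring

theorem integral_pow_mul_moment {h : ℝ → ℂ} (hi : ∀ a b, IntervalIntegrable h volume a b)
    (hc : ∀ x, 0 < x → ContinuousAt h x) (n m : ℕ) {l : ℝ} (hl : 0 < l) :
    ∫ x in (0 : ℝ)..l, (x : ℂ) ^ n * moment h m x
      = (l ^ (n + 1) * moment h m l - moment h (n + 1 + m) l) / (n + 1) := by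
  have := integral_pow_mul_primitive (intervalIntegrable_pow_mul hi m)
    (fun x hx => ContinuousAt.mul (by fun_prop) (hc x hx)) n hl
  simp only [moment, this, pow_add _ (n + 1) m, mul_assoc]

/-- Integral of a convolution kernel against an affine function. -/
theorem integral_comp_abs_sub_mul_affine {h : ℝ → ℂ}
    (hi : ∀ a b, IntervalIntegrable h volume a b) (α β : ℂ) {x l : ℝ} (hx : x ∈ Icc 0 l) :
    ∫ y in (0 : ℝ)..l, h |x - y| * (α + β * y)
      = (α + β * x) * (moment h 0 x + moment h 0 (l - x))
        + β * (moment h 1 (l - x) - moment h 1 x) := by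
  have hint : ∀ a b : ℝ, IntervalIntegrable (fun y : ℝ => h |x - y| * (α + β * y)) volume a b :=
    fun a b => (intervalIntegrable_comp_abs_sub hi x a b).mul_continuousOn (by fun_prop)
  have hm : ∀ (c d : ℂ) (b : ℝ), ∫ w in (0 : ℝ)..b, h w * (c + d * w)
      = c * moment h 0 b + d * moment h 1 b := by
    intro c d b
    rw [moment, moment, ← intervalIntegral.integral_const_mul,
      ← intervalIntegral.integral_const_mul, ← intervalIntegral.integral_add
        ((intervalIntegrable_pow_mul hi 0 0 b).const_mul c)
        ((intervalIntegrable_pow_mul hi 1 0 b).const_mul d)]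
    refine intervalIntegral.integral_congr fun w _ => ?_
    ring
  rw [← intervalIntegral.integral_add_adjacent_intervals (hint 0 x) (hint x l)]
  -- Left of `x` the substitution is `w = x - y`, so the slope changes sign; right of `x` it is `w =
  -- y - x`.
  have h1 : ∫ y in (0 : ℝ)..x, h |x - y| * (α + β * y)
      = ∫ w in (0 : ℝ)..x, h w * ((α + β * x) + (-β) * w) := by
    have := intervalIntegral.integral_comp_sub_left (a := 0) (b := x)
      (fun w : ℝ => h w * ((α + β * x) + (-β) * w)) x
    rw [sub_self, sub_zero] at this
    rw [← this]
    refine intervalIntegral.integral_congr fun y hy => ?_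
    rw [uIcc_of_le hx.1] at hy
    simp only [abs_of_nonneg (sub_nonneg.2 hy.2)]
    push_cast
    ring
  have h2 : ∫ y in x..l, h |x - y| * (α + β * y)
      = ∫ w in (0 : ℝ)..(l - x), h w * ((α + β * x) + β * w) := by
    have := intervalIntegral.integral_comp_sub_right (a := x) (b := l)
      (fun w : ℝ => h w * ((α + β * x) + β * w)) x
    rw [sub_self] at this
    rw [← this]
    refine intervalIntegral.integral_congr fun y hy => ?_
    rw [uIcc_of_le hx.2] at hy
    simp only [abs_of_nonpos (sub_nonpos.2 hy.1), neg_sub]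
    push_cast
    ring
  rw [h1, h2, hm, hm]
  ring

/-- A bilinear polynomial in two real variables. -/
noncomputable def bilin (p q r t : ℂ) (x y : ℝ) : ℂ := p + q * x + r * y + t * (x * y)

theorem intervalIntegrable_kernel {h : ℝ → ℂ} (hi : ∀ a b, IntervalIntegrable h volume a b)
    (p q r t : ℂ) (x a b : ℝ) :
    IntervalIntegrable (fun y => h |x - y| * bilin p q r t x y) volume a b :=
  (intervalIntegrable_comp_abs_sub hi x a b).mul_continuousOn (by unfold bilin; fun_prop)

theorem integral_kernel_eq {h : ℝ → ℂ} (hi : ∀ a b, IntervalIntegrable h volume a b)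
    (p q r t : ℂ) {x l : ℝ} (hx : x ∈ Icc 0 l) :
    ∫ y in (0 : ℝ)..l, h |x - y| * bilin p q r t x y
      = bilin p q r t x x * (moment h 0 x + moment h 0 (l - x))
        + (r + t * x) * (moment h 1 (l - x) - moment h 1 x) := by
  have h1 : ∀ y : ℝ, bilin p q r t x y = (p + q * x) + (r + t * x) * y := fun y => by
    rw [bilin]; ring
  simp only [h1, integral_comp_abs_sub_mul_affine hi _ _ hx]

theorem intervalIntegrable_integral_kernel {h : ℝ → ℂ}
    (hi : ∀ a b, IntervalIntegrable h volume a b) (p q r t : ℂ) {l : ℝ} (hl : 0 < l) :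
    IntervalIntegrable (fun x => ∫ y in (0 : ℝ)..l, h |x - y| * bilin p q r t x y)
      volume 0 l := by
  have h0 := continuous_moment hi 0
  have h1 := continuous_moment hi 1
  have : Continuous fun x : ℝ => bilin p q r t x x * (moment h 0 x + moment h 0 (l - x))
        + (r + t * x) * (moment h 1 (l - x) - moment h 1 x) := by
    unfold bilin; fun_prop
  refine (this.intervalIntegrable 0 l).congr fun x hx => ?_
  rw [uIoc_of_le hl.le] at hx
  exact (integral_kernel_eq hi p q r t ⟨hx.1.le, hx.2⟩).symm

/-- After the reflection `x ↦ l - x` all moments are taken at `x`; integrating them by parts, the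
contributions of order 2 cancel. -/
theorem integral_integral_kernel {h : ℝ → ℂ} (hi : ∀ a b, IntervalIntegrable h volume a b)
    (hc : ∀ x, 0 < x → ContinuousAt h x) (p q r t : ℂ) {l : ℝ} (hl : 0 < l) :
    ∫ x in (0 : ℝ)..l, ∫ y in (0 : ℝ)..l, h |x - y| * bilin p q r t x y
      = (2 * p + (q + r) * l + t * l ^ 2) * (l * moment h 0 l - moment h 1 l)
        + t / 3 * (moment h 3 l - l ^ 3 * moment h 0 l) := by
  have h0 := continuous_moment hi 0
  have h1 := continuous_moment hi 1
  have c1 : Continuous fun x : ℝ => bilin p q r t x x * moment h 0 x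
      - (r + t * x) * moment h 1 x := by unfold bilin; fun_prop
  have c2 : Continuous fun x : ℝ => bilin p q r t (l - x) (l - x) * moment h 0 x
      + (r + t * (l - x)) * moment h 1 x := by unfold bilin; fun_prop
  -- Written with `l - (l - x)` so that it is literally the function of `c2` composed with `x ↦ l -
  -- x`.
  have c3 : Continuous fun x : ℝ => bilin p q r t (l - (l - x)) (l - (l - x)) * moment h 0 (l - x)
      + (r + t * (l - (l - x : ℝ))) * moment h 1 (l - x) := by unfold bilin; fun_prop
  have e1 : ∫ x in (0 : ℝ)..l, ∫ y in (0 : ℝ)..l, h |x - y| * bilin p q r t x y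
      = ∫ x in (0 : ℝ)..l, ((bilin p q r t x x * moment h 0 x - (r + t * x) * moment h 1 x)
        + (bilin p q r t (l - (l - x)) (l - (l - x)) * moment h 0 (l - x)
          + (r + t * (l - (l - x : ℝ))) * moment h 1 (l - x))) := by
    refine intervalIntegral.integral_congr fun x hx => ?_
    rw [uIcc_of_le hl.le] at hx
    simp only [integral_kernel_eq hi p q r t hx, sub_sub_cancel]
    push_cast
    ring
  have e2 := intervalIntegral.integral_comp_sub_left (a := 0) (b := l)
    (fun x : ℝ => bilin p q r t (l - x) (l - x) * moment h 0 x
      + (r + t * (l - x)) * moment h 1 x) l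
  rw [sub_self, sub_zero] at e2
  rw [e1, intervalIntegral.integral_add (c1.intervalIntegrable _ _)
    (c3.intervalIntegrable _ _), e2,
    ← intervalIntegral.integral_add (c1.intervalIntegrable _ _) (c2.intervalIntegrable _ _)]
  have e3 : ∀ x : ℝ, (bilin p q r t x x * moment h 0 x - (r + t * x) * moment h 1 x)
      + (bilin p q r t (l - x) (l - x) * moment h 0 x + (r + t * (l - x)) * moment h 1 x)
      = (2 * p + (q + r) * l + t * l ^ 2) * ((x : ℂ) ^ 0 * moment h 0 x)
        + (-2 * t * l) * ((x : ℂ) ^ 1 * moment h 0 x)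
        + (2 * t) * ((x : ℂ) ^ 2 * moment h 0 x)
        + (t * l) * ((x : ℂ) ^ 0 * moment h 1 x)
        + (-2 * t) * ((x : ℂ) ^ 1 * moment h 1 x) := fun x => by
    simp only [bilin]
    push_cast
    ring
  have ci : ∀ (c : ℂ) (n m : ℕ), IntervalIntegrable (fun x : ℝ => c * ((x : ℂ) ^ n * moment h m x))
      volume 0 l := fun c n m => by
    have := continuous_moment hi m
    exact Continuous.intervalIntegrable (by fun_prop) _ _
  simp only [e3]
  rw [intervalIntegral.integral_add ((((ci _ _ _).add (ci _ _ _)).add (ci _ _ _)).add (ci _ _ _))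
      (ci _ _ _),
    intervalIntegral.integral_add (((ci _ _ _).add (ci _ _ _)).add (ci _ _ _)) (ci _ _ _),
    intervalIntegral.integral_add ((ci _ _ _).add (ci _ _ _)) (ci _ _ _),
    intervalIntegral.integral_add (ci _ _ _) (ci _ _ _)]
  simp only [intervalIntegral.integral_const_mul, integral_pow_mul_moment hi hc _ _ hl]
  norm_num
  ring

/-! ### Iterated principal value integrals -/

theorem HelmholtzBEM.Segment.dist_point (S : Segment) (x y : ℝ) :
    dist (S.point x) (S.point y) = |x - y| := by
  have hl := S.length_pos
  rw [Segment.point, Segment.point, dist_add_left, dist_eq_norm, ← sub_smul, norm_smul,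
    ← dist_eq_norm S.rB, dist_comm S.rB, ← Segment.length, Real.norm_eq_abs, ← sub_div, abs_div,
    abs_of_pos hl, div_mul_cancel₀ _ hl.ne']

theorem HelmholtzBEM.Segment.iterated_integral (S : Segment) {h : ℝ → ℂ}
    (hi : ∀ a b, IntervalIntegrable h volume a b) (hc : ∀ x, 0 < x → ContinuousAt h x)
    (p q r t : ℂ) {F : Plane → Plane → ℂ}
    (hF : ∀ x y, F (S.point x) (S.point y) = h |x - y| * bilin p q r t x y) :
    S.DoubleConverges S F ∧ S.integral (fun r => S.pv r (F r))
      = (2 * p + (q + r) * S.length + t * S.length ^ 2)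
          * (S.length * moment h 0 S.length - moment h 1 S.length)
        + t / 3 * (moment h 3 S.length - S.length ^ 3 * moment h 0 S.length) := by
  have hl := S.length_pos
  have hpos : ∀ x y : ℝ, y ≠ x → 0 < |x - y| := fun x y hxy => abs_pos.2 (sub_ne_zero.2 hxy.symm)
  have hpv : ∀ x, S.pv (S.point x) (F (S.point x))
      = ∫ y in (0 : ℝ)..S.length, h |x - y| * bilin p q r t x y := fun x => by
    simp only [Segment.pv, hF, S.dist_point]
    exact pvIntegral_eq_integral hl.le (by fun_prop) (hpos x)
      (intervalIntegrable_kernel hi p q r t x _ _)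
  refine ⟨⟨fun x _ => ?_, ?_⟩, ?_⟩
  · simp only [hF, S.dist_point]
    exact pvConverges_of_intervalIntegrable hl.le (by fun_prop) (hpos x)
      (intervalIntegrable_kernel hi p q r t x _ _)
  · simp only [hpv]
    exact intervalIntegrable_integral_kernel hi p q r t hl
  · simp only [Segment.integral, hpv]
    exact integral_integral_kernel hi hc p q r t hl

/-- The shift `y ↦ y + x` leads to the same double integral as on the segment, so `I_ab` and `Υ̃_ab`
are compared through one closed form. -/
theorem iterated_integral_local {h : ℝ → ℂ}
    (hi : ∀ a b, IntervalIntegrable h volume a b) (hc : ∀ x, 0 < x → ContinuousAt h x)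
    (p q r t : ℂ) {l : ℝ} (hl : 0 < l) {F : ℝ → ℝ → ℂ}
    (hF : ∀ x y, F x y = h |y| * bilin p q r t x (y + x)) :
    ((∀ x ∈ Icc 0 l, PVConverges (-x) (l - x) (fun y => |y|) (F x)) ∧
      IntervalIntegrable (fun x => pvIntegral (-x) (l - x) (fun y => |y|) (F x)) volume 0 l) ∧
    ∫ x in (0 : ℝ)..l, pvIntegral (-x) (l - x) (fun y => |y|) (F x)
      = (2 * p + (q + r) * l + t * l ^ 2) * (l * moment h 0 l - moment h 1 l)
        + t / 3 * (moment h 3 l - l ^ 3 * moment h 0 l) := by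
  have hpos : ∀ y : ℝ, y ≠ 0 → 0 < |y| := fun y hy => abs_pos.2 hy
  have hint : ∀ x a b, IntervalIntegrable (F x) volume a b := fun x a b => by
    rw [funext (hF x)]
    exact (intervalIntegrable_comp_abs hi a b).mul_continuousOn (by unfold bilin; fun_prop)
  have hpv : ∀ x, pvIntegral (-x) (l - x) (fun y => |y|) (F x)
      = ∫ y in (0 : ℝ)..l, h |x - y| * bilin p q r t x y := fun x => by
    rw [pvIntegral_eq_integral (by linarith) (by fun_prop) hpos (hint x _ _),
      ← zero_sub, ← intervalIntegral.integral_comp_sub_right]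
    simp only [hF, sub_add_cancel, abs_sub_comm]
  refine ⟨⟨fun x _ => pvConverges_of_intervalIntegrable (by linarith) (by fun_prop) hpos
    (hint x _ _), ?_⟩, ?_⟩
  · simp only [hpv]
    exact intervalIntegrable_integral_kernel hi p q r t hl
  · simp only [hpv]
    exact integral_integral_kernel hi hc p q r t hl

/-! ### Geometry of a segment -/

theorem HelmholtzBEM.Segment.length_sq (S : Segment) :
    (S.rB 0 - S.rA 0) ^ 2 + (S.rB 1 - S.rA 1) ^ 2 = S.length ^ 2 := by
  rw [Segment.length, dist_comm, EuclideanSpace.dist_eq, Real.sq_sqrt (by positivity)]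
  simp [Fin.sum_univ_two, Real.dist_eq, sq_abs]

theorem HelmholtzBEM.Segment.inner_normal_self (S : Segment) :
    inner ℝ S.normal S.normal = (1 : ℝ) := by
  have hl := S.length_pos.ne'
  have h := S.length_sq
  rw [Segment.normal, real_inner_smul_left, real_inner_smul_right]
  simp only [PiLp.inner_apply, Fin.sum_univ_two, RCLike.inner_apply, conj_trivial]
  simp
  field_simp
  linear_combination h

theorem HelmholtzBEM.Segment.hasFDerivAt_hat_B (S : Segment) (r : Plane) :
    HasFDerivAt (S.hat .B) ((1 / S.length ^ 2) • innerSL ℝ (S.rB - S.rA)) r := by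
  have h : S.hat .B = fun r => 1 / S.length ^ 2 * (innerSL ℝ (S.rB - S.rA) r
      - inner ℝ (S.rB - S.rA) S.rA) := by
    ext r
    simp only [Segment.hat, shape, innerSL_apply_apply]
    rw [← inner_sub_right, real_inner_comm]
  rw [h]
  exact ((innerSL ℝ (S.rB - S.rA)).hasFDerivAt.sub_const _).const_mul _

theorem HelmholtzBEM.Segment.curlS_hat_B (S : Segment) (r : Plane) :
    curlS S.normal (S.hat .B) r = 1 / S.length := by
  have hl := S.length_pos.ne'
  have h := S.length_sq
  rw [curlS, (S.hasFDerivAt_hat_B r).fderiv]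
  simp [Segment.normal, PiLp.inner_apply]
  field_simp
  linear_combination h

theorem HelmholtzBEM.Segment.curlS_hat_A (S : Segment) (r : Plane) :
    curlS S.normal (S.hat .A) r = -(1 / S.length) := by
  have h : S.hat .A = fun r => 1 - S.hat .B r := rfl
  rw [← S.curlS_hat_B r, curlS, curlS, h, fderiv_const_sub]
  simp
  ring

/-! ### The kernels on a segment -/

/-- Slope of a shape function. -/
def shapeSlope : Endpoint → ℝ
  | .A => -1
  | .B => 1

theorem shape_eq (a : Endpoint) (t : ℝ) : shape a t = shape a 0 + shapeSlope a * t := by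
  cases a <;> simp only [shape, shapeSlope] <;> ring

theorem HelmholtzBEM.Segment.curlS_hat (S : Segment) (a : Endpoint) (r : Plane) :
    curlS S.normal (S.hat a) r = shapeSlope a / S.length := by
  cases a
  · rw [S.curlS_hat_A, shapeSlope]; ring
  · rw [S.curlS_hat_B, shapeSlope]

theorem green_point (κ : HankelKind) (k : ℝ) (S : Segment) (x y : ℝ) :
    green κ k (S.point x) (S.point y)
      = hankel κ 0 (k * |x - y|) * bilin (Complex.I / 4) 0 0 0 x y := by
  rw [green, S.dist_point, bilin]
  ring

/-- The product of curls is constant, so it enters the first coefficient only; the others come from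
the product of shape functions. -/
theorem variationalKernel_point (κ : HankelKind) (k : ℝ) (S : Segment) (a b : Endpoint)
    (x y : ℝ) :
    variationalKernel κ k S S a b (S.point x) (S.point y) = hankel κ 0 (k * |x - y|) *
      bilin (Complex.I / 4 * (k ^ 2 * (shape a 0 * shape b 0 : ℝ)
            - (shapeSlope a * shapeSlope b : ℝ) / S.length ^ 2))
        (Complex.I / 4 * (k ^ 2 * (shapeSlope a * shape b 0 : ℝ) / S.length))
        (Complex.I / 4 * (k ^ 2 * (shape a 0 * shapeSlope b : ℝ) / S.length))
        (Complex.I / 4 * (k ^ 2 * (shapeSlope a * shapeSlope b : ℝ) / S.length ^ 2)) x y := by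
  have hl : (S.length : ℂ) ≠ 0 := by exact_mod_cast S.length_pos.ne'
  rw [variationalKernel, green, S.dist_point, bilin, S.curlS_hat, S.curlS_hat, S.hat_point,
    S.hat_point, S.inner_normal_self, shape_eq a, shape_eq b]
  push_cast
  field_simp
  ring

theorem singleKernel_eq (κ : HankelKind) (k l : ℝ) (a b : Endpoint) (x y : ℝ) :
    singleKernel κ k l a b x y = hankel κ 0 (k * |y|) *
      bilin (shape a 0 * shape b 0 : ℝ) ((shapeSlope a * shape b 0 : ℝ) / l)
        ((shape a 0 * shapeSlope b : ℝ) / l) ((shapeSlope a * shapeSlope b : ℝ) / l ^ 2)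
        x (y + x) := by
  rw [singleKernel, bilin, shape_eq a, shape_eq b]
  push_cast
  ring

/-! ### Scaled Hankel function -/

theorem intervalIntegrable_hankel_zero_mul (κ : HankelKind) {k : ℝ} (hk : 0 < k) (a b : ℝ) :
    IntervalIntegrable (fun w => hankel κ 0 (k * w)) volume a b := by
  have := (intervalIntegrable_hankel_zero κ (k * a) (k * b)).comp_mul_left (c := k)
  simpa [mul_div_cancel_left₀ _ hk.ne'] using this

theorem continuousAt_hankel_zero_mul (κ : HankelKind) {k : ℝ} (hk : 0 < k) (x : ℝ) (hx : 0 < x) :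
    ContinuousAt (fun w => hankel κ 0 (k * w)) x :=
  ContinuousAt.comp (f := fun w => k * w)
    (hasDerivAt_hankel_zero κ (mul_pos hk hx).ne').continuousAt (by fun_prop)

theorem moment_hankel_zero_mul (κ : HankelKind) {k : ℝ} (hk : 0 < k) (n : ℕ) (l : ℝ) :
    moment (fun w => hankel κ 0 (k * w)) n l = moment (hankel κ 0) n (k * l) / k ^ (n + 1) := by
  have hk' : (k : ℂ) ≠ 0 := by exact_mod_cast hk.ne'
  have h := intervalIntegral.integral_comp_mul_left (a := 0) (b := l)
    (fun u : ℝ => (u : ℂ) ^ n * hankel κ 0 u) hk.ne'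
  rw [mul_zero] at h
  have h1 : ∀ w : ℝ, (w : ℂ) ^ n * hankel κ 0 (k * w)
      = (1 / (k : ℂ) ^ n) * (((k * w : ℝ) : ℂ) ^ n * hankel κ 0 (k * w)) := fun w => by
    push_cast
    field_simp
    ring
  simp only [moment, h1, intervalIntegral.integral_const_mul, h, Complex.real_smul]
  push_cast
  field_simp
  ring

theorem continuous_hankelInt (κ : HankelKind) : Continuous (hankelInt κ) :=
  intervalIntegral.continuous_primitive (intervalIntegrable_hankel_zero κ) 0

theorem hankelInt_eq_moment (κ : HankelKind) (s : ℝ) : hankelInt κ s = moment (hankel κ 0) 0 s := by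
  simp [hankelInt, moment]

theorem continuousAt_hankel_zero (κ : HankelKind) (x : ℝ) (hx : 0 < x) :
    ContinuousAt (hankel κ 0) x := (hasDerivAt_hankel_zero κ hx.ne').continuousAt

/-! ### `Γ_0` and `Γ_2` through moments and Struve functions -/

theorem gammaZero_eq_moment (κ : HankelKind) {s : ℝ} (hs : 0 < s) :
    gammaZero κ s = s * moment (hankel κ 0) 0 s - moment (hankel κ 0) 1 s := by
  have := integral_pow_mul_moment (intervalIntegrable_hankel_zero κ)
    (continuousAt_hankel_zero κ) 0 0 hs
  simp only [pow_zero, one_mul] at this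
  simp only [gammaZero, hankelInt_eq_moment, this]
  norm_num

theorem gammaTwo_eq_moment (κ : HankelKind) {s : ℝ} (hs : 0 < s) :
    gammaTwo κ s = -(s ^ 3 / 6) * moment (hankel κ 0) 0 s + s / 2 * moment (hankel κ 0) 2 s
      - moment (hankel κ 0) 3 s / 3 := by
  have hi := intervalIntegrable_hankel_zero κ
  have h1 := integral_pow_mul_moment hi (continuousAt_hankel_zero κ) 1 0 hs
  have h2 := integral_pow_mul_moment hi (continuousAt_hankel_zero κ) 2 0 hs
  have hm := continuous_moment hi 0
  have e : ∀ x : ℝ, moment (hankel κ 0) 0 x * ((x * (x - s) : ℝ) : ℂ)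
      = (x : ℂ) ^ 2 * moment (hankel κ 0) 0 x - s * ((x : ℂ) ^ 1 * moment (hankel κ 0) 0 x) :=
    fun x => by push_cast; ring
  simp only [gammaTwo, hankelInt_eq_moment, e]
  rw [intervalIntegral.integral_sub (Continuous.intervalIntegrable (by fun_prop) _ _)
    (Continuous.intervalIntegrable (by fun_prop) _ _), intervalIntegral.integral_const_mul, h1, h2]
  norm_num
  ring

theorem gammaZero_eq_integral (κ : HankelKind) {s : ℝ} (hs : 0 < s) :
    gammaZero κ s = π / 2 * ∫ x in (0 : ℝ)..s, (x : ℂ) * hankelStruve κ x := by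
  rw [gammaZero, ← intervalIntegral.integral_const_mul]
  -- The Struve formula for `𝓘_0` is available for `x > 0` only; the half-open interval of
  -- integration excludes 0.
  refine intervalIntegral.integral_congr_ae (Eventually.of_forall fun x hx => ?_)
  rw [uIoc_of_le hs.le] at hx
  exact hankelInt_eq κ hx.1

theorem gammaTwo_eq_integral (κ : HankelKind) {s : ℝ} (hs : 0 < s) :
    gammaTwo κ s = π / 2 * ∫ x in (0 : ℝ)..s, (x : ℂ) ^ 2 * (x - s) * hankelStruve κ x := by
  rw [gammaTwo, ← intervalIntegral.integral_const_mul]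
  refine intervalIntegral.integral_congr_ae (Eventually.of_forall fun x hx => ?_)
  rw [uIoc_of_le hs.le] at hx
  rw [hankelInt_eq κ hx.1]
  push_cast
  ring

theorem intervalIntegrable_mul_hankelStruve (κ : HankelKind) {s : ℝ} (hs : 0 < s) :
    IntervalIntegrable (fun x : ℝ => (x : ℂ) * hankelStruve κ x) volume 0 s := by
  have hπ : (π : ℂ) ≠ 0 := by exact_mod_cast Real.pi_ne_zero
  refine (((continuous_hankelInt κ).intervalIntegrable 0 s).const_mul (2 / π : ℂ)).congr
    fun x hx => ?_
  rw [uIoc_of_le hs.le] at hx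
  simp only [hankelInt_eq κ hx.1]
  field_simp

/-! ### Closed forms -/

/-- Iterated integral of the kernel against a bilinear polynomial, in terms of `Γ_0`. -/
theorem scaled_integral_eq (κ : HankelKind) {k l : ℝ} (hk : 0 < k) (hl : 0 < l) (c t : ℂ) :
    c * (l * moment (fun w => hankel κ 0 (k * w)) 0 l - moment (fun w => hankel κ 0 (k * w)) 1 l)
      + t / 3 * (moment (fun w => hankel κ 0 (k * w)) 3 l
        - l ^ 3 * moment (fun w => hankel κ 0 (k * w)) 0 l)
    = c * gammaZero κ (k * l) / k ^ 2
      + t / 3 * (moment (hankel κ 0) 3 (k * l) - (k * l) ^ 3 * moment (hankel κ 0) 0 (k * l))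
        / k ^ 4 := by
  have hk' : (k : ℂ) ≠ 0 := by exact_mod_cast hk.ne'
  simp only [moment_hankel_zero_mul κ hk, gammaZero_eq_moment κ (mul_pos hk hl)]
  push_cast
  field_simp

theorem green_iterated_integral (κ : HankelKind) {k : ℝ} (hk : 0 < k) (S : Segment) :
    S.DoubleConverges S (green κ k) ∧ S.integral (fun r => S.pv r (green κ k r))
      = Complex.I / (2 * k ^ 2) * gammaZero κ (k * S.length) := by
  have h := S.iterated_integral (intervalIntegrable_hankel_zero_mul κ hk)
    (continuousAt_hankel_zero_mul κ hk) _ _ _ _ (green_point κ k S)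
  rw [scaled_integral_eq κ hk S.length_pos] at h
  refine ⟨h.1, h.2.trans ?_⟩
  have hk' : (k : ℂ) ≠ 0 := by exact_mod_cast hk.ne'
  field_simp
  ring

theorem variationalKernel_iterated_integral (κ : HankelKind) {k : ℝ} (hk : 0 < k) (S : Segment)
    (a b : Endpoint) :
    S.DoubleConverges S (variationalKernel κ k S S a b) ∧ upsilonTilde κ k S a b
      = k ^ 2 * singleI κ k S.length a b
        - (shapeSlope a * shapeSlope b : ℝ) / S.length ^ 2 *
          (Complex.I / (2 * k ^ 2) * gammaZero κ (k * S.length)) := by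
  have h := S.iterated_integral (intervalIntegrable_hankel_zero_mul κ hk)
    (continuousAt_hankel_zero_mul κ hk) _ _ _ _ (variationalKernel_point κ k S a b)
  have h' := iterated_integral_local (intervalIntegrable_hankel_zero_mul κ hk)
    (continuousAt_hankel_zero_mul κ hk) _ _ _ _ S.length_pos
    (singleKernel_eq κ k S.length a b)
  rw [scaled_integral_eq κ hk S.length_pos] at h h'
  refine ⟨h.1, h.2.trans ?_⟩
  rw [singleI, h'.2]
  have hk' : (k : ℂ) ≠ 0 := by exact_mod_cast hk.ne'
  have hl : (S.length : ℂ) ≠ 0 := by exact_mod_cast S.length_pos.ne'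
  field_simp
  ring

/-- The coefficient of `Γ_0` equals `φ_a(0) φ_b(0) + φ_a(1) φ_b(1)`, that is 1 if `a = b` and 0
otherwise, while the rest is odd in the product of slopes. This gives the relation between `I_12`
and `I_11`. -/
theorem singleI_eq (κ : HankelKind) {k l : ℝ} (hk : 0 < k) (hl : 0 < l) (a b : Endpoint) :
    SingleConverges κ k l a b ∧ singleI κ k l a b
      = Complex.I / 4 * ((2 * (shape a 0 * shape b 0 : ℝ) + (shapeSlope a * shape b 0 : ℝ)
            + (shape a 0 * shapeSlope b : ℝ) + (shapeSlope a * shapeSlope b : ℝ))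
          * gammaZero κ (k * l) / k ^ 2
        + (shapeSlope a * shapeSlope b : ℝ) / l ^ 2 / 3
          * (moment (hankel κ 0) 3 (k * l) - (k * l) ^ 3 * moment (hankel κ 0) 0 (k * l))
            / k ^ 4) := by
  have h := iterated_integral_local (intervalIntegrable_hankel_zero_mul κ hk)
    (continuousAt_hankel_zero_mul κ hk) _ _ _ _ hl (singleKernel_eq κ k l a b)
  rw [scaled_integral_eq κ hk hl] at h
  refine ⟨h.1, ?_⟩
  rw [singleI, h.2]
  have hl' : (l : ℂ) ≠ 0 := by exact_mod_cast hl.ne'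
  congr 4
  field_simp
  ring

/-- Subtracting `6 Γ_2` leaves `3 (m_3 - s m_2)`, with `m_n` the moment of order `n` at `s`. There
`s^3 H_1` cancels, and `s^2 H_0` cancels against the `2 / π` in `𝐇_{-1} = 2 / π - 𝐇_1`. -/
theorem cube_moment_eq (κ : HankelKind) {s : ℝ} (hs : 0 < s) :
    moment (hankel κ 0) 3 s - s ^ 3 * moment (hankel κ 0) 0 s
      = 3 * s ^ 2 * (π / 2 * (hankel κ 1 s * struve 0 s - hankel κ 0 s * struve 1 s)
          - 2 * hankel κ 2 s) - κ.sign * Complex.I * (24 / π) + 6 * gammaTwo κ s := by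
  have hπ : (π : ℂ) ≠ 0 := by exact_mod_cast Real.pi_ne_zero
  have h3 : moment (hankel κ 0) 3 s = _ := integral_cube_mul_hankel_zero κ hs
  have h2 : moment (hankel κ 0) 2 s = _ := integral_sq_mul_hankel_zero κ hs
  rw [gammaTwo_eq_moment κ hs, h3, h2, ← hankelInt_eq_moment,
    hankelInt_eq κ hs, hankelStruve, struve_neg_one]
  push_cast
  field_simp
  ring

theorem singleI_A_A_eq (κ : HankelKind) {k l : ℝ} (hk : 0 < k) (hl : 0 < l) :
    singleI κ k l .A .A =
        Complex.I * π / (8 * k ^ 2) *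
            (hankel κ 1 (k * l) * struve 0 (k * l)
              - hankel κ 0 (k * l) * struve 1 (k * l))
          - Complex.I / (2 * k ^ 2) * hankel κ 2 (k * l)
          + κ.sign * (2 / (π * k ^ 4 * l ^ 2))
          + Complex.I / (4 * k ^ 2) * gammaZero κ (k * l)
          + Complex.I / (2 * k ^ 4 * l ^ 2) * gammaTwo κ (k * l) := by
  have hπ : (π : ℂ) ≠ 0 := by exact_mod_cast Real.pi_ne_zero
  have hk' : (k : ℂ) ≠ 0 := by exact_mod_cast hk.ne'
  have hl' : (l : ℂ) ≠ 0 := by exact_mod_cast hl.ne'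
  have h := cube_moment_eq κ (mul_pos hk hl)
  push_cast at h
  rw [(singleI_eq κ hk hl .A .A).2, h]
  simp only [shape, shapeSlope]
  push_cast
  field_simp
  -- The boundary constant carries a factor `i` and meets the prefactor `i / 4`; `i^2 = -1` makes it
  -- the real term with sign `±`.
  linear_combination (-384 * κ.sign) * Complex.I_sq

/-! ### Assembly of the theorem -/

theorem mainTheorem3 {V E : Type*} [Fintype E] (M : Mesh V E)
    (κ : HankelKind) (k : ℝ) (hk : 0 < k) :
    (∀ (S : Segment) (l : ℝ), l = S.length →
      -- surface curl of the hat functions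
      (∀ r, curlS S.normal (S.hat .A) r = -(1 / l)) ∧
      (∀ r, curlS S.normal (S.hat .B) r = 1 / l) ∧
      -- all integrals are well defined
      (∀ a b, S.DoubleConverges S (variationalKernel κ k S S a b)) ∧
      S.DoubleConverges S (green κ k) ∧
      (∀ a b, SingleConverges κ k l a b) ∧
      IntervalIntegrable (hankel κ 0) volume 0 (k * l) ∧
      IntervalIntegrable (hankelInt κ) volume 0 (k * l) ∧
      IntervalIntegrable (fun x : ℝ => (x : ℂ) * hankelStruve κ x)
        volume 0 (k * l) ∧
      -- the diagonal contributions
      upsilonTilde κ k S .A .A = upsilonTilde κ k S .B .B ∧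
      upsilonTilde κ k S .A .A =
        k ^ 2 * singleI κ k l .A .A
          - 1 / l ^ 2 * S.integral (fun r => S.pv r (green κ k r)) ∧
      upsilonTilde κ k S .A .A =
        k ^ 2 * singleI κ k l .A .A
          - Complex.I / (2 * k ^ 2 * l ^ 2) * gammaZero κ (k * l) ∧
      -- the off-diagonal contributions
      upsilonTilde κ k S .A .B = upsilonTilde κ k S .B .A ∧
      upsilonTilde κ k S .A .B =
        k ^ 2 * singleI κ k l .A .B
          + 1 / l ^ 2 * S.integral (fun r => S.pv r (green κ k r)) ∧
      upsilonTilde κ k S .A .B =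
        k ^ 2 * singleI κ k l .A .B
          + Complex.I / (2 * k ^ 2 * l ^ 2) * gammaZero κ (k * l) ∧
      -- the closed forms of the quantities on the right-hand sides
      singleI κ k l .A .A = singleI κ k l .B .B ∧
      singleI κ k l .A .A =
        Complex.I * π / (8 * k ^ 2) *
            (hankel κ 1 (k * l) * struve 0 (k * l)
              - hankel κ 0 (k * l) * struve 1 (k * l))
          - Complex.I / (2 * k ^ 2) * hankel κ 2 (k * l)
          + κ.sign * (2 / (π * k ^ 4 * l ^ 2))
          + Complex.I / (4 * k ^ 2) * gammaZero κ (k * l)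
          + Complex.I / (2 * k ^ 4 * l ^ 2) * gammaTwo κ (k * l) ∧
      singleI κ k l .A .B = singleI κ k l .B .A ∧
      singleI κ k l .A .B =
        -singleI κ k l .A .A
          + Complex.I / (4 * k ^ 2) * gammaZero κ (k * l) ∧
      gammaZero κ (k * l) =
        π / 2 * ∫ x in (0 : ℝ)..(k * l), (x : ℂ) * hankelStruve κ x ∧
      gammaTwo κ (k * l) =
        π / 2 * ∫ x in (0 : ℝ)..(k * l),
          (x : ℂ) ^ 2 * (x - (k * l : ℝ)) * hankelStruve κ x) ∧
    -- the coincident elements contribute exactly these quantities to the matrix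
    ∀ i j : V, M.hypersingular κ k i j =
      (∑ p ∈ M.star i, ∑ q ∈ M.star j, open Classical in
        if p.1 = q.1 then 0
        else elementTerm κ k (M.segment p.1) (M.segment q.1) p.2 q.2) +
      ∑ p ∈ M.star i, ∑ q ∈ M.star j, open Classical in
        if p.1 = q.1 then upsilonTilde κ k (M.segment p.1) p.2 q.2 else 0 := by
  refine ⟨?_, fun i j => ?_⟩
  · rintro S l rfl
    have hl := S.length_pos
    have hs := mul_pos hk hl
    have hΥ := fun a b => (variationalKernel_iterated_integral κ hk S a b).2
    have hI := fun a b => (singleI_eq κ hk hl a b).2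
    have hG := (green_iterated_integral κ hk S).2
    have hI1 : singleI κ k S.length .A .A = singleI κ k S.length .B .B := by
      simp only [hI, shape, shapeSlope]
      push_cast
      ring
    have hI2 : singleI κ k S.length .A .B = singleI κ k S.length .B .A := by
      simp only [hI, shape, shapeSlope]
      push_cast
      ring
    refine ⟨S.curlS_hat_A, S.curlS_hat_B,
      fun a b => (variationalKernel_iterated_integral κ hk S a b).1,
      (green_iterated_integral κ hk S).1, fun a b => (singleI_eq κ hk hl a b).1,
      intervalIntegrable_hankel_zero κ _ _, (continuous_hankelInt κ).intervalIntegrable _ _,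
      intervalIntegrable_mul_hankelStruve κ hs, ?_, ?_, ?_, ?_, ?_, ?_, hI1,
      singleI_A_A_eq κ hk hl, hI2, ?_, gammaZero_eq_integral κ hs, ?_⟩
    · rw [hΥ, hΥ, hI1]; simp [shapeSlope]
    · rw [hΥ, hG]; simp [shapeSlope]
    · rw [hΥ]; simp only [shapeSlope]; push_cast; field_simp
    · rw [hΥ, hΥ, hI2]; simp [shapeSlope]
    · rw [hΥ, hG]; simp only [shapeSlope]; push_cast; ring
    · rw [hΥ]; simp only [shapeSlope]; push_cast; field_simp; ring
    · simp only [hI, shape, shapeSlope]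
      push_cast
      ring
    · rw [gammaTwo_eq_integral κ hs]
  -- Each pair of incident elements lands in exactly one of the two sums, according to whether the
  -- elements coincide.
  · rw [Mesh.hypersingular, ← Finset.sum_add_distrib]
    refine Finset.sum_congr rfl fun p _ => ?_
    rw [← Finset.sum_add_distrib]
    refine Finset.sum_congr rfl fun q _ => ?_
    split_ifs with h
    · rw [upsilonTilde, h, zero_add]
    · rw [add_zero]
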